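/- For integers $n\ge 1$, $d\ge 3$ let $\mathcal G(n,d)$ be the random bipartite graph with sides $V_1,V_2$ of size $n$ each that is the union of $d$ independent, uniformly random perfect matchings between $V_1$ and $V_2$ (parallel edges are allowed; they may be merged without changing anything below). For a finite graph $G$ and $\lambda>0$, the hard-core distribution $\mu_{G,\lambda}$ gives each independent set $I$ of $G$ probability proportional to $\lambda^{|I|}$. The Glauber dynamics is the following Markov chain on the independent sets: from $I$, choose a vertex $v$ uniformly at random; if no neighbour of $v$ is in $I$, make $v$ occupied with probability $\lambda/(\lambda+1)$ and unoccupied otherwise; if some neighbour of $v$ is in $I$, make $v$ unoccupied. The mixing time $T_{\mathrm{mix}}(P)\in\mathbb N\cup\{\infty\}$ of a chain $P$ with stationary distribution $\mu_{G,\lambda}$ is the least $t$ such that from every starting state the law after $t$ steps is within total variation distance $1/(2e)$ of $\mu_{G,\lambda}$. Let $\lambda_c(d)=(d-1)^{d-1}/(d-2)^d$. **Theorem.** For every $d\ge 3$ there is $\varepsilon_d>0$ such that for every $\lambda$ with $\lambda_c(d)<\lambda<\lambda_c(d)+\varepsilon_d$ there are $a=a(\lambda,d)>1$ and $c=c(\lambda,d)>0$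 with the following properties. 1. With probability tending to $1$ as $n\to\infty$, the mixing time of the Glauber dynamics on $G\sim\mathcal G(n,d)$ is at least $c\,a^n$. 2. For every $k:\mathbb N\to\mathbb N$ with $k(n)=o(n)$, with probability tending to $1$ as $n\to\infty$, the graph $G\sim\mathcal G(n,d)$ is such that every Markov chain on its independent sets that is reversible with respect to $\mu_{G,\lambda}$ and changes the state of at most $k(n)$ vertices in each step (i.e. $P(I,J)>0$ implies $|I\,\triangle\,J|\le k(n)$) has mixing time at least $c\,a^n$. -/

import Mathlib

open Filter Topology Asymptotics

noncomputable section

namespace HardCore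

/-! ### Finite Markov chains -/

section Chains

variable {S : Type*} [Fintype S] [DecidableEq S]

/-- Total variation distance between two probability vectors on a finite set. -/
def tvDist (p q : S → ℝ) : ℝ := (1 / 2) * ∑ x, |p x - q x|

/-- The mixing time of the chain with transition matrix `P` and stationary distribution `π`:
the least `t` such that, from every starting state, the law after `t` steps is within total
variation distance `1 / (2e)` of `π`. It is `⊤` if there is no such `t`. -/
def mixingTime (P : Matrix S S ℝ) (π : S → ℝ) : ℕ∞ :=
  ⨅ (t : ℕ) (_ : ∀ x, tvDist ((P ^ t) x) π ≤ 1 / (2 * Real.exp 1)), (t : ℕ∞)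

/-- `P` is the transition matrix of a Markov chain that is reversible with respect to `π`
(detailed balance). -/
def IsReversibleChain (P : Matrix S S ℝ) (π : S → ℝ) : Prop :=
  P ∈ Matrix.rowStochastic ℝ S ∧ ∀ x y, π x * P x y = π y * P y x

end Chains

/-! ### The hard-core model on a finite graph -/

section Model

variable {V : Type*} [Fintype V] [DecidableEq V]

/-- The independent sets of a finite graph. -/
def IndepSets (G : SimpleGraph V) : Type _ := {I : Finset V // G.IsIndepSet (I : Set V)}

instance (G : SimpleGraph V) : Fintype (IndepSets G) :=
  letI : Finite (IndepSets G) :=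
    inferInstanceAs (Finite {I : Finset V // G.IsIndepSet (I : Set V)})
  Fintype.ofFinite _

instance (G : SimpleGraph V) : DecidableEq (IndepSets G) :=
  inferInstanceAs (DecidableEq {I : Finset V // G.IsIndepSet (I : Set V)})

/-- The hard-core distribution with activity `lam`. -/
def hardCore (G : SimpleGraph V) (lam : ℝ) (I : IndepSets G) : ℝ :=
  lam ^ I.1.card / ∑ J : IndepSets G, lam ^ J.1.card

open Classical in
/-- Transition matrix of the Glauber dynamics: a vertex `v` is chosen uniformly at random; if all
its neighbours are unoccupied, then `v` becomes occupied with probability `lam / (lam + 1)` and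
unoccupied with the remaining probability; if some neighbour is occupied, then `v` is set to be
unoccupied. -/
def glauber (G : SimpleGraph V) (lam : ℝ) : Matrix (IndepSets G) (IndepSets G) ℝ :=
  fun I J => (1 / (Fintype.card V : ℝ)) * ∑ v : V,
    if ∀ w, G.Adj v w → w ∉ I.1 then
      lam / (lam + 1) * (if J.1 = insert v I.1 then 1 else 0)
        + (1 - lam / (lam + 1)) * (if J.1 = I.1.erase v then 1 else 0)
    else (if J.1 = I.1.erase v then 1 else 0)

/-- Every step of the chain changes the state (occupied or not) of at most `k` vertices. -/
def UpdatesAtMost {G : SimpleGraph V} (k : ℕ) (P : Matrix (IndepSets G) (IndepSets G) ℝ) : Prop :=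
  ∀ I J, P I J ≠ 0 → (symmDiff I.1 J.1).card ≤ k

end Model

/-! ### The random graph -/

/-- The bipartite graph with sides `V₁ = V₂ = Fin n` that is the union of the `d` perfect
matchings `i ↦ σ k i`; parallel edges are merged, which does not affect the hard-core model. -/
def matchingGraph {n d : ℕ} (σ : Fin d → Equiv.Perm (Fin n)) : SimpleGraph (Fin n ⊕ Fin n) :=
  SimpleGraph.fromRel fun u v => ∃ i k, u = Sum.inl i ∧ v = Sum.inr (σ k i)

/-- Probability of an event when `d` perfect matchings between two `n`-sets are chosen
independently and uniformly at random. -/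
def matchingProb (n d : ℕ) (E : Set (Fin d → Equiv.Perm (Fin n))) : ℝ :=
  (E.ncard : ℝ) / (Fintype.card (Fin d → Equiv.Perm (Fin n)) : ℝ)

/-- The critical activity of the `d`-regular tree. -/
def lamCrit (d : ℕ) : ℝ := ((d : ℝ) - 1) ^ (d - 1) / ((d : ℝ) - 2) ^ d

end HardCore

end

/-!
By Markov's inequality, with high probability the number of independent sets with `a` left and `b`
right vertices is, up to a polynomial factor, at most its expectation, for all `a` and `b` at once.
A matching lower bound on the partition function holds for *every* union of `d` perfect matchings,
also with different activities `x`, `y` on the two sides: summing out the right vertices leaves a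
log-supermodular weight on the left subsets, hence the partition function of an `M`-fold lift is at
most the `M`-th power of that of the graph, while its average over all lifts is at least a first
moment that determines the exponential rate as `M → ∞`. Taking `x = lam * exp s` and
`y = lam * exp (-s)` tilts the measure towards the imbalanced independent sets. Above the critical
activity the exponential rate is maximal only off the diagonal, so both kinds of imbalanced sets
outweigh the balanced ones exponentially, and a reversible chain with small steps has to pass
through the balanced sets.
-/

noncomputable section

namespace HardCore

/-! ### Log-supermodular weights -/

section LogSupermodular

/-- Log-supermodularity of a weight on a lattice: the FKG lattice condition. -/
def LogSupermodular {L : Type*} [Lattice L] (F : L → ℝ) : Prop :=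
  ∀ x y, F x * F y ≤ F (x ⊓ y) * F (x ⊔ y)

lemma add_sum_mul_nonneg_of_antitone {M : ℕ} {p : Fin M → ℝ} (hp : Antitone p)
    (hp0 : ∀ i, 0 ≤ p i) {T : ℝ} (hT : 0 ≤ T) (hpT : ∀ i, p i ≤ T) {c : ℝ} {δ : ℕ → ℝ}
    (hδ : ∀ k ≤ M, 0 ≤ c + ∑ i ∈ Finset.range k, δ i) :
    0 ≤ T * c + ∑ i : Fin M, p i * δ i := by
  induction M generalizing T c δ with
  | zero => simpa using mul_nonneg hT (by simpa using hδ 0 le_rfl)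
  | succ M ih =>
    have hc : 0 ≤ c := by simpa using hδ 0 (Nat.zero_le _)
    have htail : 0 ≤ p 0 * (c + δ 0) + ∑ i : Fin M, p i.succ * δ (i + 1) := by
      refine ih (fun i j hij => hp (Fin.succ_le_succ_iff.2 hij)) (fun i => hp0 _) (hp0 0)
        (fun i => hp (Fin.zero_le _)) (δ := fun i => δ (i + 1)) fun k hk => ?_
      have h := hδ (k + 1) (by omega)
      rw [Finset.sum_range_succ'] at h
      linarith
    have hhead : p 0 * c ≤ T * c := mul_le_mul_of_nonneg_right (hpT 0) hc
    rw [Fin.sum_univ_succ]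
    simp only [Fin.val_zero, Fin.val_succ]
    linarith

lemma LogSupermodular.log_le_add_sum {α : Type*} [LinearOrder α] [LocallyFiniteOrderBot α]
    {F : Finset α → ℝ} (hF : LogSupermodular F) (hF0 : ∀ A, 0 < F A) (A : Finset α) :
    Real.log (F A) ≤ Real.log (F ∅) +
      ∑ i ∈ A, (Real.log (F (Finset.Iic i)) - Real.log (F (Finset.Iio i))) := by
  induction A using Finset.induction_on_max with
  | empty => simp
  | insert m A hlt ih =>
    have hm : m ∉ A := fun h => lt_irrefl _ (hlt m h)
    have hinf : insert m A ⊓ Finset.Iio m = A := by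
      ext j
      simp only [Finset.inf_eq_inter, Finset.mem_inter, Finset.mem_insert, Finset.mem_Iio]
      exact ⟨fun h => h.1.resolve_left h.2.ne, fun h => ⟨Or.inr h, hlt j h⟩⟩
    have hsup : insert m A ⊔ Finset.Iio m = Finset.Iic m := by
      ext j
      simp only [Finset.sup_eq_union, Finset.mem_union, Finset.mem_insert, Finset.mem_Iio,
        Finset.mem_Iic, le_iff_eq_or_lt]
      have := hlt j
      tauto
    have hlog := Real.log_le_log (mul_pos (hF0 _) (hF0 _)) (hF (insert m A) (Finset.Iio m))
    rw [hinf, hsup, Real.log_mul (hF0 _).ne' (hF0 _).ne',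
      Real.log_mul (hF0 _).ne' (hF0 _).ne'] at hlog
    rw [Finset.sum_insert hm]
    linarith

lemma LogSupermodular.log_le_add_sum_fin {M : ℕ} {F : Finset (Fin M) → ℝ}
    (hF : LogSupermodular F) (hF0 : ∀ A, 0 < F A) (A : Finset (Fin M)) :
    Real.log (F A) ≤ Real.log (F ∅) + ∑ i ∈ A,
      (Real.log (F {j | (j : ℕ) < (i : ℕ) + 1}) - Real.log (F {j | (j : ℕ) < (i : ℕ)})) := by
  have hIio : ∀ i : Fin M, Finset.Iio i = ({j | (j : ℕ) < (i : ℕ)} : Finset (Fin M)) :=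
    fun i => by ext j; simp
  have hIic : ∀ i : Fin M, Finset.Iic i = ({j | (j : ℕ) < (i : ℕ) + 1} : Finset (Fin M)) :=
    fun i => by ext j; simp [Order.lt_add_one_iff]
  simpa only [hIio, hIic] using hF.log_le_add_sum hF0 A

lemma sum_mul_add_sum_mem {α : Type*} [Fintype α] [DecidableEq α] (F : Finset α → ℝ) (c : ℝ)
    (δ : α → ℝ) :
    ∑ A, F A * (c + ∑ i ∈ A, δ i) = (∑ A, F A) * c + ∑ i, (∑ A with i ∈ A, F A) * δ i := by
  simp_rw [mul_add, Finset.sum_add_distrib, Finset.mul_sum, Finset.sum_mul]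
  congr 1
  exact Finset.sum_comm' (by simp)

lemma sum_le_sum_of_sum_mul_log_nonneg {ι : Type*} [Fintype ι] {F G : ι → ℝ}
    (hF : ∀ i, 0 < F i) (hG : ∀ i, 0 < G i)
    (h : 0 ≤ ∑ i, F i * (Real.log (G i) - Real.log (F i))) : ∑ i, F i ≤ ∑ i, G i := by
  have hterm : ∀ i, F i * (Real.log (G i) - Real.log (F i)) ≤ G i - F i := fun i => by
    have hlog := mul_le_mul_of_nonneg_left
      (Real.log_le_sub_one_of_pos (div_pos (hG i) (hF i))) (hF i).le
    rwa [Real.log_div (hG i).ne' (hF i).ne', mul_sub (F i) (G i / F i),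
      mul_div_cancel₀ _ (hF i).ne', mul_one] at hlog
  have := h.trans (Finset.sum_le_sum fun i _ => hterm i)
  rw [Finset.sum_sub_distrib] at this
  linarith

-- By Gibbs' inequality it is enough that the relative entropy of `F` with respect to the product
-- weight is nonpositive; log-supermodularity reduces this to the initial segments, which carry
-- the hypothesis `hFr`, and the antitone marginals make the summation by parts go through.
lemma LogSupermodular.sum_le_of_antitone_marginals {M : ℕ} {F : Finset (Fin M) → ℝ}
    (hF : LogSupermodular F) (hF0 : ∀ A, 0 < F A) {r : ℕ → ℝ} (hr : ∀ i, 0 < r i) {C : ℝ}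
    (hC : 0 < C) (hFr : ∀ A, F A ≤ C * ∏ i ∈ Finset.range A.card, r i)
    (hmarg : Antitone fun i : Fin M => ∑ A with i ∈ A, F A) :
    ∑ A, F A ≤ C * ∏ i ∈ Finset.range M, (1 + r i) := by
  set g : ℕ → ℝ := fun k => Real.log (F {j | (j : ℕ) < k}) with hg
  set c : ℝ := Real.log C - g 0
  set δ : ℕ → ℝ := fun i => Real.log (r i) - (g (i + 1) - g i)
  have hg0 : g 0 = Real.log (F ∅) := by simp [hg]
  have hprefix : ∀ k ≤ M, 0 ≤ c + ∑ i ∈ Finset.range k, δ i := fun k hk => by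
    have h := Real.log_le_log (hF0 _) (hFr {j | (j : ℕ) < k})
    rw [Fin.card_filter_val_lt, min_eq_right hk,
      Real.log_mul hC.ne' (Finset.prod_pos fun i _ => hr i).ne',
      Real.log_prod fun i _ => (hr i).ne'] at h
    rw [Finset.sum_sub_distrib, Finset.sum_range_sub]
    linarith
  have habel : 0 ≤ (∑ A, F A) * c + ∑ i : Fin M, (∑ A with i ∈ A, F A) * δ i :=
    add_sum_mul_nonneg_of_antitone hmarg (fun i => Finset.sum_nonneg fun A _ => (hF0 A).le)
      (Finset.sum_nonneg fun A _ => (hF0 A).le)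
      (fun i => Finset.sum_le_sum_of_subset_of_nonneg (Finset.subset_univ _)
        fun A _ _ => (hF0 A).le) hprefix
  have hprodpos : ∀ A : Finset (Fin M), 0 < ∏ i ∈ A, r i := fun A =>
    Finset.prod_pos fun i _ => hr i
  have hlogG : ∀ A : Finset (Fin M),
      c + ∑ i ∈ A, δ i ≤ Real.log (C * ∏ i ∈ A, r i) - Real.log (F A) := fun A => by
    have h := hF.log_le_add_sum_fin hF0 A
    rw [Real.log_mul hC.ne' (hprodpos A).ne', Real.log_prod fun (i : Fin M) _ => (hr i).ne',
      Finset.sum_sub_distrib]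
    linarith
  have hprod : C * ∏ i ∈ Finset.range M, (1 + r i) = ∑ A : Finset (Fin M), C * ∏ i ∈ A, r i := by
    rw [← Finset.mul_sum, ← Fin.prod_univ_eq_prod_range (fun i => 1 + r i), Finset.prod_one_add,
      Finset.powerset_univ]
  rw [hprod]
  refine sum_le_sum_of_sum_mul_log_nonneg hF0 (fun A => mul_pos hC (hprodpos A)) (habel.trans ?_)
  rw [← sum_mul_add_sum_mem F c fun i => δ i]
  exact Finset.sum_le_sum fun A _ => mul_le_mul_of_nonneg_left (hlogG A) (hF0 A).le

lemma LogSupermodular.comp_map {α β : Type*} [DecidableEq α] [DecidableEq β]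
    {F : Finset β → ℝ} (hF : LogSupermodular F) (f : α ↪ β) :
    LogSupermodular fun A : Finset α => F (A.map f) := by
  intro A B
  simpa only [Finset.inf_eq_inter, Finset.sup_eq_union, Finset.map_inter, Finset.map_union]
    using hF (A.map f) (B.map f)

lemma sum_map_perm {α : Type*} [Fintype α] (F : Finset α → ℝ) (τ : Equiv.Perm α) :
    ∑ A : Finset α, F (A.map τ.toEmbedding) = ∑ A, F A :=
  Fintype.sum_equiv τ.finsetCongr _ _ fun _ => rfl

lemma sum_mem_map_perm {α : Type*} [Fintype α] [DecidableEq α] (F : Finset α → ℝ)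
    (τ : Equiv.Perm α) (i : α) :
    ∑ A : Finset α with i ∈ A, F (A.map τ.toEmbedding) = ∑ A with τ i ∈ A, F A := by
  simp only [Finset.sum_filter]
  exact Fintype.sum_equiv τ.finsetCongr _ _ fun A => by simp

lemma LogSupermodular.sum_le_prod_one_add {M : ℕ} {F : Finset (Fin M) → ℝ}
    (hF : LogSupermodular F) (hF0 : ∀ A, 0 < F A) {r : ℕ → ℝ} (hr : ∀ i, 0 < r i) {C : ℝ}
    (hC : 0 < C) (hFr : ∀ A, F A ≤ C * ∏ i ∈ Finset.range A.card, r i) :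
    ∑ A, F A ≤ C * ∏ i ∈ Finset.range M, (1 + r i) := by
  -- Relabelling by decreasing marginals reduces to the antitone case.
  set τ : Equiv.Perm (Fin M) := Tuple.sort fun i => -∑ A with i ∈ A, F A
  rw [← sum_map_perm F τ]
  refine (hF.comp_map τ.toEmbedding).sum_le_of_antitone_marginals (fun A => hF0 _) hr hC
    (fun A => by simpa using hFr (A.map τ.toEmbedding)) fun i j hij => ?_
  beta_reduce
  rw [sum_mem_map_perm F τ i, sum_mem_map_perm F τ j, ← neg_le_neg_iff]
  exact Tuple.monotone_sort (fun i => -∑ A with i ∈ A, F A) hij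

lemma cons_inf {m : ℕ} {α : Type*} [Lattice α] (a b : α) (x y : Fin m → α) :
    (Fin.cons a x : Fin (m + 1) → α) ⊓ Fin.cons b y = Fin.cons (a ⊓ b) (x ⊓ y) := by
  funext i
  refine Fin.cases ?_ (fun i => ?_) i <;> simp

lemma cons_sup {m : ℕ} {α : Type*} [Lattice α] (a b : α) (x y : Fin m → α) :
    (Fin.cons a x : Fin (m + 1) → α) ⊔ Fin.cons b y = Fin.cons (a ⊔ b) (x ⊔ y) := by
  funext i
  refine Fin.cases ?_ (fun i => ?_) i <;> simp

lemma LogSupermodular.cons_left {m : ℕ} {α : Type*} [Lattice α] {F : (Fin (m + 1) → α) → ℝ}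
    (hF : LogSupermodular F) (x : Fin m → α) : LogSupermodular fun a => F (Fin.cons a x) := by
  intro a b
  simpa only [cons_inf, cons_sup, inf_idem, sup_idem] using hF (Fin.cons a x) (Fin.cons b x)

lemma LogSupermodular.sum_cons {m : ℕ} {α : Type*} [DistribLattice α] [Fintype α]
    {F : (Fin (m + 1) → α) → ℝ} (hF : LogSupermodular F) (hF0 : ∀ x, 0 ≤ F x) :
    LogSupermodular fun x : Fin m → α => ∑ a, F (Fin.cons a x) := by
  intro x y
  refine four_functions_theorem_univ _ _ _ _ (fun _ => hF0 _) (fun _ => hF0 _) (fun _ => hF0 _)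
    (fun _ => hF0 _) fun a b => ?_
  simpa only [cons_inf, cons_sup] using hF (Fin.cons a x) (Fin.cons b y)

lemma sum_eq_sum_sum_cons {m : ℕ} {α : Type*} [Fintype α] (F : (Fin (m + 1) → α) → ℝ) :
    ∑ x, F x = ∑ x : Fin m → α, ∑ a, F (Fin.cons a x) := by
  rw [← Fintype.sum_equiv (Fin.consEquiv fun _ => α) (fun p => F (Fin.cons p.1 p.2)) F
    fun p => rfl, Fintype.sum_prod_type, Finset.sum_comm]

/-- The `i`-th level set of a family of finite sets, as an indicator: the coordinates whose set
has more than `i` elements. The levels encode the family up to relabelling inside coordinates. -/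
def level {m M : ℕ} (x : Fin m → Finset (Fin M)) (i : ℕ) : Fin m → Bool :=
  fun v => decide (i < (x v).card)

lemma level_cons {m M : ℕ} (A : Finset (Fin M)) (x : Fin m → Finset (Fin M)) (i : ℕ) :
    level (Fin.cons A x) i = Fin.cons (decide (i < A.card)) (level x i) := by
  funext v
  refine Fin.cases ?_ (fun v => ?_) v <;> simp [level]

lemma prod_level_cons {m M : ℕ} {g : (Fin (m + 1) → Bool) → ℝ} (hg : ∀ z, g z ≠ 0)
    (A : Finset (Fin M)) (x : Fin m → Finset (Fin M)) :
    ∏ i ∈ Finset.range M, g (level (Fin.cons A x) i) =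
      (∏ i ∈ Finset.range M, g (Fin.cons false (level x i))) *
        ∏ i ∈ Finset.range A.card,
          g (Fin.cons true (level x i)) / g (Fin.cons false (level x i)) := by
  have hrange : Finset.range A.card = {i ∈ Finset.range M | i < A.card} := by
    have hA : A.card ≤ M := by simpa using A.card_le_univ
    ext i
    simp only [Finset.mem_range, Finset.mem_filter]
    omega
  rw [hrange, Finset.prod_filter, ← Finset.prod_mul_distrib]
  refine Finset.prod_congr rfl fun i _ => ?_
  rw [level_cons]
  by_cases hi : i < A.card
  · rw [if_pos hi, mul_div_cancel₀ _ (hg _), decide_eq_true hi]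
  · rw [if_neg hi, mul_one, decide_eq_false hi]

theorem LogSupermodular.sum_le_pow_of_le_prod_level {m M : ℕ} {F : (Fin m → Finset (Fin M)) → ℝ}
    {g : (Fin m → Bool) → ℝ} (hF : LogSupermodular F) (hF0 : ∀ x, 0 < F x) (hg : ∀ z, 0 < g z)
    (hFg : ∀ x, F x ≤ ∏ i ∈ Finset.range M, g (level x i)) :
    ∑ x, F x ≤ (∑ z, g z) ^ M := by
  induction m with
  | zero =>
    rw [Fintype.sum_unique, Fintype.sum_unique]
    refine (hFg _).trans_eq ?_
    rw [Finset.prod_congr rfl fun i _ => congrArg g (Subsingleton.elim (level _ i) default),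
      Finset.prod_const, Finset.card_range]
    exact congrArg (g · ^ M) (Subsingleton.elim _ _)
  | succ m ih =>
    rw [sum_eq_sum_sum_cons F, sum_eq_sum_sum_cons g]
    refine ih (hF.sum_cons fun x => (hF0 x).le)
      (fun x => Finset.sum_pos (fun _ _ => hF0 _) Finset.univ_nonempty)
      (fun z => Finset.sum_pos (fun _ _ => hg _) Finset.univ_nonempty) fun x => ?_
    refine ((hF.cons_left x).sum_le_prod_one_add (fun A => hF0 _)
      (fun i => div_pos (hg _) (hg _)) (Finset.prod_pos fun i _ => hg _) fun A =>
      (hFg _).trans_eq (prod_level_cons (fun z => (hg z).ne') A x)).trans_eq ?_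
    rw [← Finset.prod_mul_distrib]
    refine Finset.prod_congr rfl fun i _ => ?_
    rw [Fintype.sum_bool, mul_one_add, mul_div_cancel₀ _ (hg _).ne', add_comm]

end LogSupermodular

/-! ### Expected numbers of independent pairs -/

section Avoiding

lemma exists_perm_mem_iff {α : Type*} [Finite α] {A A' : Finset α}
    (h : A.card = A'.card) :
    ∃ ρ : Equiv.Perm α, ∀ j, ρ j ∈ A' ↔ j ∈ A := by
  classical
  set e : {x // x ∈ A} ≃ {x // x ∈ A'} := Finset.equivOfCardEq h
  refine ⟨e.extendSubtype, fun j => ⟨fun hj => ?_, e.extendSubtype_mem j⟩⟩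
  by_contra hj'
  exact e.extendSubtype_not_mem j hj' hj

variable {α : Type*} [Fintype α] [DecidableEq α]

/-- The permutations mapping `A` into the complement of `B`: the matchings for which the pair of a
left set `A` and a right set `B` is independent. -/
def avoidingPerms (A B : Finset α) : Finset (Equiv.Perm α) := {τ | ∀ j ∈ A, τ j ∉ B}

lemma card_avoidingPerms_congr {A A' : Finset α} (B : Finset α) (h : A.card = A'.card) :
    (avoidingPerms A B).card = (avoidingPerms A' B).card := by
  obtain ⟨ρ, hρ⟩ := exists_perm_mem_iff h
  refine Finset.card_equiv (Equiv.mulRight ρ⁻¹) fun τ => ?_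
  simp only [avoidingPerms, Finset.mem_filter_univ, Equiv.coe_mulRight, Equiv.Perm.mul_apply]
  refine ⟨fun hτ j hj => hτ _ ((hρ _).1 (by simpa using hj)), fun hτ j hj => ?_⟩
  simpa using hτ _ ((hρ j).2 hj)

lemma card_avoidingPerms_mul_choose (A B : Finset α) :
    (avoidingPerms A B).card * (Fintype.card α).choose A.card =
      (Fintype.card α).factorial * (Fintype.card α - B.card).choose A.card := by
  have havoid : ∀ τ : Equiv.Perm α,
      {A' ∈ Finset.powersetCard A.card (Finset.univ : Finset α) | ∀ j ∈ A', τ j ∉ B} =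
        Finset.powersetCard A.card (Bᶜ.map τ.symm.toEmbedding) := fun τ => by
    ext A'
    simp [Finset.subset_iff, Finset.mem_map_equiv, and_comm]
  have hcount := Finset.card_mul_eq_card_mul (s := Finset.powersetCard A.card Finset.univ)
    (t := (Finset.univ : Finset (Equiv.Perm α))) (fun A' τ => ∀ j ∈ A', τ j ∉ B)
    (m := (avoidingPerms A B).card) (n := (Fintype.card α - B.card).choose A.card)
    (fun A' hA' => card_avoidingPerms_congr B (Finset.mem_powersetCard.1 hA').2)
    (fun τ _ => by
      rw [Finset.bipartiteBelow, havoid, Finset.card_powersetCard, Finset.card_map,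
        Finset.card_compl])
  rwa [Finset.card_powersetCard, Finset.card_univ, Finset.card_univ, Fintype.card_perm,
    mul_comm] at hcount

/-- The probability that a uniformly random permutation of an `n`-set maps a given `a`-set into
the complement of a given `b`-set. -/
def avoidProb (n a b : ℕ) : ℝ := (n - b).choose a / n.choose a

lemma avoidProb_nonneg (n a b : ℕ) : 0 ≤ avoidProb n a b := by
  unfold avoidProb
  positivity

lemma card_avoidingPerms (A B : Finset α) :
    ((avoidingPerms A B).card : ℝ) =
      (Fintype.card α).factorial * avoidProb (Fintype.card α) A.card B.card := by
  have h : (0 : ℝ) < (Fintype.card α).choose A.card := by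
    exact_mod_cast Nat.choose_pos A.card_le_univ
  rw [avoidProb, ← mul_div_assoc, eq_div_iff h.ne']
  exact_mod_cast card_avoidingPerms_mul_choose A B

end Avoiding

section FirstMoment

/-- The expected number of independent sets with `a` vertices on the left and `b` on the right in
the union of `d` random perfect matchings of two `n`-sets. -/
def expectedPairs (d n a b : ℕ) : ℝ := n.choose a * n.choose b * avoidProb n a b ^ d

lemma expectedPairs_nonneg (d n a b : ℕ) : 0 ≤ expectedPairs d n a b :=
  mul_nonneg (by positivity) (pow_nonneg (avoidProb_nonneg _ _ _) _)

variable {n d : ℕ}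

/-- The independent sets of the union of the matchings `σ`, as pairs of a left and a right
part. -/
def indepPairs (σ : Fin d → Equiv.Perm (Fin n)) : Finset (Finset (Fin n) × Finset (Fin n)) :=
  {p | ∀ k, ∀ i ∈ p.1, σ k i ∉ p.2}

lemma mem_indepPairs {σ : Fin d → Equiv.Perm (Fin n)} {p : Finset (Fin n) × Finset (Fin n)} :
    p ∈ indepPairs σ ↔ ∀ k, ∀ i ∈ p.1, σ k i ∉ p.2 := Finset.mem_filter_univ p

/-- The number of independent sets with `a` vertices on the left and `b` on the right. -/
def numPairs (σ : Fin d → Equiv.Perm (Fin n)) (a b : ℕ) : ℕ :=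
  {p ∈ indepPairs σ | p.1.card = a ∧ p.2.card = b}.card

lemma card_mem_indepPairs (A B : Finset (Fin n)) :
    ({σ : Fin d → Equiv.Perm (Fin n) | (A, B) ∈ indepPairs σ} : Finset _).card =
      (avoidingPerms A B).card ^ d := by
  have hpi : ({σ : Fin d → Equiv.Perm (Fin n) | (A, B) ∈ indepPairs σ} : Finset _) =
      Fintype.piFinset fun _ => avoidingPerms A B := by
    ext σ
    simp [mem_indepPairs, avoidingPerms]
  rw [hpi, Fintype.card_piFinset_const]

lemma card_perms : Fintype.card (Fin d → Equiv.Perm (Fin n)) = n.factorial ^ d := by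
  simp [Fintype.card_perm]

lemma sum_numPairs (n d a b : ℕ) :
    ∑ σ : Fin d → Equiv.Perm (Fin n), (numPairs σ a b : ℝ) =
      Fintype.card (Fin d → Equiv.Perm (Fin n)) * expectedPairs d n a b := by
  set T : Finset (Finset (Fin n) × Finset (Fin n)) :=
    Finset.powersetCard a Finset.univ ×ˢ Finset.powersetCard b Finset.univ with hT
  have hnum : ∀ σ : Fin d → Equiv.Perm (Fin n),
      numPairs σ a b = {p ∈ T | p ∈ indepPairs σ}.card := fun σ => by
    rw [numPairs]
    congr 1
    ext p
    simp [hT, and_comm]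
  have hpair : ∀ p ∈ T, (({σ : Fin d → Equiv.Perm (Fin n) | p ∈ indepPairs σ} : Finset _).card : ℝ)
      = (n.factorial * avoidProb n a b) ^ d := by
    rintro ⟨A, B⟩ hp
    obtain ⟨rfl, rfl⟩ : A.card = a ∧ B.card = b := by simpa [hT] using hp
    rw [card_mem_indepPairs, Nat.cast_pow, card_avoidingPerms, Fintype.card_fin]
  have hcount := Finset.sum_card_bipartiteAbove_eq_sum_card_bipartiteBelow (s := T)
    (t := (Finset.univ : Finset (Fin d → Equiv.Perm (Fin n)))) fun p σ => p ∈ indepPairs σ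
  calc ∑ σ : Fin d → Equiv.Perm (Fin n), (numPairs σ a b : ℝ)
      = ∑ p ∈ T, (({σ : Fin d → Equiv.Perm (Fin n) | p ∈ indepPairs σ} : Finset _).card : ℝ) := by
        simp_rw [hnum]
        exact_mod_cast hcount.symm
    _ = T.card * (n.factorial * avoidProb n a b) ^ d := by
        rw [Finset.sum_congr rfl hpair, Finset.sum_const, nsmul_eq_mul]
    _ = Fintype.card (Fin d → Equiv.Perm (Fin n)) * expectedPairs d n a b := by
        simp only [hT, Finset.card_product, Finset.card_powersetCard, Finset.card_univ,
          Fintype.card_fin, card_perms, expectedPairs]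
        push_cast
        ring

lemma numPairs_eq_zero_of_expectedPairs_eq_zero {a b : ℕ} (h : expectedPairs d n a b = 0)
    (σ : Fin d → Equiv.Perm (Fin n)) : numPairs σ a b = 0 := by
  have hsum := sum_numPairs n d a b
  rw [h, mul_zero, Finset.sum_eq_zero_iff_of_nonneg fun _ _ => Nat.cast_nonneg _] at hsum
  exact_mod_cast hsum σ (Finset.mem_univ _)

lemma matchingProb_mono {E F : Set (Fin d → Equiv.Perm (Fin n))} (h : E ⊆ F) :
    matchingProb n d E ≤ matchingProb n d F :=
  div_le_div_of_nonneg_right (by exact_mod_cast Set.ncard_le_ncard h F.toFinite)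
    (Nat.cast_nonneg _)

lemma matchingProb_le_one (E : Set (Fin d → Equiv.Perm (Fin n))) : matchingProb n d E ≤ 1 := by
  refine div_le_one_of_le₀ ?_ (Nat.cast_nonneg _)
  rw [← Nat.card_eq_fintype_card]
  exact_mod_cast Set.ncard_le_card E

lemma one_sub_div_le_matchingProb_le {X : (Fin d → Equiv.Perm (Fin n)) → ℝ} (hX : ∀ σ, 0 ≤ X σ)
    {K t : ℝ} (ht : 0 < t)
    (hK : ∑ σ, X σ ≤ Fintype.card (Fin d → Equiv.Perm (Fin n)) * K) :
    1 - K / t ≤ matchingProb n d {σ | X σ ≤ t} := by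
  classical
  set N : ℝ := (Fintype.card (Fin d → Equiv.Perm (Fin n)) : ℝ) with hN
  have hNpos : 0 < N := Nat.cast_pos.2 Fintype.card_pos
  have hind : ∀ σ, 1 - X σ / t ≤ if X σ ≤ t then 1 else 0 := fun σ => by
    split_ifs with h
    · linarith [div_nonneg (hX σ) ht.le]
    · linarith [(one_lt_div ht).2 (not_le.1 h)]
  rw [matchingProb, ← hN, le_div_iff₀ hNpos]
  calc (1 - K / t) * N = N - N * K / t := by ring
    _ ≤ N - (∑ σ, X σ) / t := by gcongr
    _ = ∑ σ, (1 - X σ / t) := by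
        rw [Finset.sum_sub_distrib, Finset.sum_div, Finset.sum_const, Finset.card_univ,
          nsmul_eq_mul, mul_one]
    _ ≤ ∑ σ, if X σ ≤ t then (1 : ℝ) else 0 := Finset.sum_le_sum fun σ _ => hind σ
    _ = ({σ | X σ ≤ t}.ncard : ℝ) := by
        rw [Finset.sum_boole, Set.ncard_eq_toFinset_card', Set.toFinset_ofPred]

/-- The matchings for which no number of independent sets of given sizes exceeds its expectation
by a factor of more than `(n + 1) ^ 3`; by Markov's inequality they are overwhelming. -/
def typicalMatchings (n d : ℕ) : Set (Fin d → Equiv.Perm (Fin n)) :=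
  {σ | ∀ a ≤ n, ∀ b ≤ n, (numPairs σ a b : ℝ) ≤ ((n : ℝ) + 1) ^ 3 * expectedPairs d n a b}

lemma sum_sum_numPairs_div_le (n d : ℕ) :
    ∑ σ : Fin d → Equiv.Perm (Fin n), ∑ p ∈ Finset.range (n + 1) ×ˢ Finset.range (n + 1),
        numPairs σ p.1 p.2 / expectedPairs d n p.1 p.2 ≤
      Fintype.card (Fin d → Equiv.Perm (Fin n)) * ((n : ℝ) + 1) ^ 2 := by
  rw [Finset.sum_comm]
  calc _ ≤ ∑ _p ∈ Finset.range (n + 1) ×ˢ Finset.range (n + 1),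
        (Fintype.card (Fin d → Equiv.Perm (Fin n)) : ℝ) := by
        refine Finset.sum_le_sum fun p _ => ?_
        rw [← Finset.sum_div, sum_numPairs, mul_div_assoc]
        exact mul_le_of_le_one_right (Nat.cast_nonneg _) (div_self_le_one _)
    _ = _ := by
        simp only [Finset.sum_const, Finset.card_product, Finset.card_range, nsmul_eq_mul]
        push_cast
        ring

lemma one_sub_le_matchingProb_typicalMatchings (n d : ℕ) :
    1 - 1 / ((n : ℝ) + 1) ≤ matchingProb n d (typicalMatchings n d) := by
  set X : (Fin d → Equiv.Perm (Fin n)) → ℝ := fun σ =>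
    ∑ p ∈ Finset.range (n + 1) ×ˢ Finset.range (n + 1),
      numPairs σ p.1 p.2 / expectedPairs d n p.1 p.2
  have hratio : ∀ (σ : Fin d → Equiv.Perm (Fin n)) (p : ℕ × ℕ),
      0 ≤ numPairs σ p.1 p.2 / expectedPairs d n p.1 p.2 := fun σ p =>
    div_nonneg (Nat.cast_nonneg _) (expectedPairs_nonneg _ _ _ _)
  have hmarkov : 1 - ((n : ℝ) + 1) ^ 2 / ((n : ℝ) + 1) ^ 3 ≤
      matchingProb n d {σ | X σ ≤ ((n : ℝ) + 1) ^ 3} :=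
    one_sub_div_le_matchingProb_le (fun σ => Finset.sum_nonneg fun p _ => hratio σ p)
      (by positivity) (sum_sum_numPairs_div_le n d)
  have htypical : {σ | X σ ≤ ((n : ℝ) + 1) ^ 3} ⊆ typicalMatchings n d := by
    intro σ hσ a ha b hb
    rcases (expectedPairs_nonneg d n a b).eq_or_lt' with h0 | hpos
    · simp [h0, numPairs_eq_zero_of_expectedPairs_eq_zero h0 σ]
    · rw [← div_le_iff₀ hpos]
      refine le_trans ?_ hσ
      exact Finset.single_le_sum (fun p _ => hratio σ p) (a := (a, b)) (by simp; omega)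
  refine le_trans (le_of_eq ?_) (hmarkov.trans (matchingProb_mono htypical))
  field_simp

end FirstMoment

/-! ### Random lifts -/

section Lift

lemma sum_pow_card_powerset {α : Type*} (s : Finset α) (y : ℝ) :
    ∑ t ∈ s.powerset, y ^ t.card = (1 + y) ^ s.card := by
  classical
  simpa using (Finset.prod_one_add (f := fun _ : α => y) (s := s)).symm

lemma pow_mul_choose_le_one_add_pow {y : ℝ} (hy : 0 ≤ y) (m b : ℕ) :
    y ^ b * m.choose b ≤ (1 + y) ^ m := by
  rw [add_comm 1 y, add_pow]
  simp only [one_pow, mul_one]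
  rcases le_or_gt b m with h | h
  · exact Finset.single_le_sum (f := fun i => y ^ i * (m.choose i : ℝ))
      (fun i _ => by positivity) (Finset.mem_range.2 (Nat.lt_succ_of_le h))
  · rw [Nat.choose_eq_zero_of_lt h, Nat.cast_zero, mul_zero]
    exact Finset.sum_nonneg fun i _ => by positivity

lemma sum_fun_bool {α : Type*} [Fintype α] [DecidableEq α] (f : Finset α → ℝ) :
    ∑ z : α → Bool, f {u | z u} = ∑ A, f A :=
  Finset.sum_nbij' (fun z => ({u | z u} : Finset α)) (fun A u => decide (u ∈ A)) (by simp) (by simp)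
    (fun z _ => by ext; simp) (fun A _ => by ext; simp) (by simp)

variable {n d M : ℕ} (σ : Fin d → Equiv.Perm (Fin n))

/-- The partition function with activities `x` on the left and `y` on the right. -/
def pairZ (x y : ℝ) : ℝ := ∑ p ∈ indepPairs σ, x ^ p.1.card * y ^ p.2.card

/-- The right vertices without a neighbour in the left set `A`. -/
def freeRight (A : Finset (Fin n)) : Finset (Fin n) := {v | ∀ k, (σ k).symm v ∉ A}

/-- The total weight of the independent sets with left part `A`. -/
def leftWeight (x y : ℝ) (A : Finset (Fin n)) : ℝ := x ^ A.card * (1 + y) ^ (freeRight σ A).card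

lemma mem_indepPairs_iff_subset_freeRight {p : Finset (Fin n) × Finset (Fin n)} :
    p ∈ indepPairs σ ↔ p.2 ⊆ freeRight σ p.1 := by
  simp only [mem_indepPairs, freeRight, Finset.subset_iff, Finset.mem_filter_univ]
  exact ⟨fun h v hv k hk => h k _ hk (by simpa using hv),
    fun h k i hi hv => h hv k (by simpa using hi)⟩

lemma sum_leftWeight (x y : ℝ) : ∑ A, leftWeight σ x y A = pairZ σ x y := by
  rw [pairZ, Finset.sum_finset_product _ Finset.univ fun A => (freeRight σ A).powerset]
  · exact Finset.sum_congr rfl fun A _ => by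
      simp only [← Finset.mul_sum, sum_pow_card_powerset, leftWeight]
  · intro p
    simp [mem_indepPairs_iff_subset_freeRight]

variable (π : Fin d → Fin n → Equiv.Perm (Fin M))

/-- In the `M`-fold lift of the union of the matchings `σ`, whose matching over the edge from `u`
to `σ k u` is `π k u`: the copies of the right vertex `v` without a neighbour in the left set
`X`. -/
def liftFree (X : Fin n → Finset (Fin M)) (v : Fin n) : Finset (Fin M) :=
  {i | ∀ k, (π k ((σ k).symm v)).symm i ∉ X ((σ k).symm v)}

/-- The total weight of the independent sets with left part `X` in the lift given by `π`. -/
def liftWeight (x y : ℝ) (X : Fin n → Finset (Fin M)) : ℝ :=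
  x ^ (∑ u, (X u).card) * (1 + y) ^ (∑ v, (liftFree σ π X v).card)

variable {x y : ℝ}

lemma leftWeight_pos (hx : 0 < x) (hy : 0 < y) (A : Finset (Fin n)) : 0 < leftWeight σ x y A := by
  unfold leftWeight
  positivity

lemma liftWeight_pos (hx : 0 < x) (hy : 0 < y) (X : Fin n → Finset (Fin M)) :
    0 < liftWeight σ π x y X := by
  unfold liftWeight
  positivity

lemma liftFree_sup (X Y : Fin n → Finset (Fin M)) (v : Fin n) :
    liftFree σ π (X ⊔ Y) v = liftFree σ π X v ∩ liftFree σ π Y v := by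
  ext i
  simp [liftFree, forall_and]

lemma union_liftFree_subset_liftFree_inf (X Y : Fin n → Finset (Fin M)) (v : Fin n) :
    liftFree σ π X v ∪ liftFree σ π Y v ⊆ liftFree σ π (X ⊓ Y) v := by
  intro i
  simp only [liftFree, Finset.mem_union, Finset.mem_filter_univ, Pi.inf_apply,
    Finset.inf_eq_inter, Finset.mem_inter]
  rintro (h | h) k hk
  exacts [h k hk.1, h k hk.2]

lemma card_liftFree_add_le (X Y : Fin n → Finset (Fin M)) (v : Fin n) :
    (liftFree σ π X v).card + (liftFree σ π Y v).card ≤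
      (liftFree σ π (X ⊓ Y) v).card + (liftFree σ π (X ⊔ Y) v).card := by
  rw [← Finset.card_union_add_card_inter, liftFree_sup]
  exact Nat.add_le_add_right
    (Finset.card_le_card (union_liftFree_subset_liftFree_inf σ π X Y v)) _

lemma logSupermodular_liftWeight (hx : 0 < x) (hy : 0 < y) :
    LogSupermodular (liftWeight σ π x y) := by
  intro X Y
  have hleft : ∑ u, (X u).card + ∑ u, (Y u).card =
      ∑ u, ((X ⊓ Y) u).card + ∑ u, ((X ⊔ Y) u).card := by
    simp only [← Finset.sum_add_distrib, Pi.inf_apply, Pi.sup_apply, Finset.inf_eq_inter,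
      Finset.sup_eq_union, Finset.card_inter_add_card_union]
  have hright : ∑ v, (liftFree σ π X v).card + ∑ v, (liftFree σ π Y v).card ≤
      ∑ v, (liftFree σ π (X ⊓ Y) v).card + ∑ v, (liftFree σ π (X ⊔ Y) v).card := by
    simp only [← Finset.sum_add_distrib]
    exact Finset.sum_le_sum fun v _ => card_liftFree_add_le σ π X Y v
  simp only [liftWeight, mul_mul_mul_comm, ← pow_add]
  rw [hleft]
  gcongr
  linarith

lemma sum_card_level (X : Fin n → Finset (Fin M)) :
    ∑ i ∈ Finset.range M, ({u | level X i u} : Finset (Fin n)).card = ∑ u, (X u).card := by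
  refine (Finset.sum_card_bipartiteAbove_eq_sum_card_bipartiteBelow
    fun i u => level X i u).trans ?_
  refine Finset.sum_congr rfl fun u _ => ?_
  have hM : (X u).card ≤ M := by simpa using (X u).card_le_univ
  have hrange : (Finset.range M).bipartiteBelow (fun i u => level X i u) u =
      Finset.range (X u).card := by
    ext i
    simp only [Finset.mem_bipartiteBelow, level, Finset.mem_range, decide_eq_true_eq]
    omega
  rw [hrange, Finset.card_range]

lemma card_liftFree_le (hd : 0 < d) (X : Fin n → Finset (Fin M)) (v : Fin n) :
    (liftFree σ π X v).card ≤
      {i ∈ Finset.range M | v ∈ freeRight σ {u | level X i u}}.card := by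
  have : Nonempty (Fin d) := ⟨⟨0, hd⟩⟩
  obtain ⟨k, hk⟩ := Finite.exists_max fun k => (X ((σ k).symm v)).card
  have hsub : liftFree σ π X v ⊆ ((X ((σ k).symm v)).map (π k ((σ k).symm v)).toEmbedding)ᶜ := by
    intro i hi
    simp only [liftFree, Finset.mem_filter_univ] at hi
    simpa only [Finset.mem_compl, Finset.mem_map_equiv] using hi k
  have hIco : Finset.Ico (X ((σ k).symm v)).card M ⊆
      {i ∈ Finset.range M | v ∈ freeRight σ {u | level X i u}} := by
    intro i hi
    rw [Finset.mem_Ico] at hi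
    simp only [freeRight, level, Finset.mem_filter, Finset.mem_range, Finset.mem_univ, true_and,
      decide_eq_true_eq, not_lt]
    exact ⟨hi.2, fun k' => (hk k').trans hi.1⟩
  calc (liftFree σ π X v).card ≤ M - (X ((σ k).symm v)).card := by
        simpa [Finset.card_compl] using Finset.card_le_card hsub
    _ ≤ _ := by simpa using Finset.card_le_card hIco

lemma liftWeight_le_prod_level (hd : 0 < d) (hx : 0 < x) (hy : 0 < y)
    (X : Fin n → Finset (Fin M)) :
    liftWeight σ π x y X ≤ ∏ i ∈ Finset.range M, leftWeight σ x y {u | level X i u} := by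
  have hright : ∑ v, (liftFree σ π X v).card ≤
      ∑ i ∈ Finset.range M, (freeRight σ {u | level X i u}).card := by
    refine (Finset.sum_le_sum fun v _ => card_liftFree_le σ π hd X v).trans_eq ?_
    refine (Finset.sum_card_bipartiteAbove_eq_sum_card_bipartiteBelow
      fun i v => v ∈ freeRight σ {u | level X i u}).symm.trans ?_
    refine Finset.sum_congr rfl fun i _ => congrArg Finset.card ?_
    ext v
    simp [Finset.mem_bipartiteAbove]
  simp only [leftWeight, Finset.prod_mul_distrib, Finset.prod_pow_eq_pow_sum]
  rw [sum_card_level, liftWeight]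
  gcongr
  linarith

lemma sum_liftWeight_le (hd : 0 < d) (hx : 0 < x) (hy : 0 < y) :
    ∑ X, liftWeight σ π x y X ≤ pairZ σ x y ^ M := by
  rw [← sum_leftWeight, ← sum_fun_bool]
  exact (logSupermodular_liftWeight σ π hx hy).sum_le_pow_of_le_prod_level
    (liftWeight_pos σ π hx hy) (fun z => leftWeight_pos σ hx hy _)
    (liftWeight_le_prod_level σ π hd hx hy)

/-- The subsets of the `M`-fold cover of an `n`-set all of whose fibres have `a` elements. -/
def uniformFibers (n M a : ℕ) : Finset (Fin n → Finset (Fin M)) :=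
  Fintype.piFinset fun _ => Finset.powersetCard a Finset.univ

lemma mem_uniformFibers {a : ℕ} {X : Fin n → Finset (Fin M)} :
    X ∈ uniformFibers n M a ↔ ∀ u, (X u).card = a := by
  simp [uniformFibers]

lemma card_uniformFibers (n M a : ℕ) : (uniformFibers n M a).card = M.choose a ^ n := by
  simp [uniformFibers]

/-- The independent sets of the lift given by `π` that contain exactly `a` copies of each left
vertex and `b` copies of each right vertex. -/
def liftPairs (a b : ℕ) : Finset ((Fin n → Finset (Fin M)) × (Fin n → Finset (Fin M))) :=
  {p ∈ uniformFibers n M a ×ˢ uniformFibers n M b | ∀ k u, ∀ j ∈ p.1 u, π k u j ∉ p.2 (σ k u)}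

lemma card_liftPairs (a b : ℕ) :
    (liftPairs σ π a b).card =
      ∑ X ∈ uniformFibers n M a, ∏ v, (liftFree σ π X v).card.choose b := by
  rw [Finset.card_eq_sum_ones, Finset.sum_finset_product _ (uniformFibers n M a)
    fun X => Fintype.piFinset fun v => Finset.powersetCard b (liftFree σ π X v)]
  · simp [Fintype.card_piFinset]
  · rintro ⟨X, B⟩
    simp only [liftPairs, Finset.mem_filter, Finset.mem_product, mem_uniformFibers,
      Fintype.mem_piFinset, Finset.mem_powersetCard, liftFree, Finset.subset_iff,
      Finset.mem_univ, true_and, forall_and, and_assoc]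
    refine and_congr_right fun _ => and_comm.trans (and_congr_left fun _ => ?_)
    exact ⟨fun h v i hi k hX => h k _ _ hX (by simpa using hi),
      fun h k u j hj hB => h (σ k u) hB k (by simpa using hj)⟩

lemma pow_mul_card_liftPairs_le (hx : 0 < x) (hy : 0 < y) (a b : ℕ) :
    (x ^ a * y ^ b) ^ n * (liftPairs σ π a b).card ≤ ∑ X, liftWeight σ π x y X := by
  have hterm : ∀ X ∈ uniformFibers n M a,
      (x ^ a * y ^ b) ^ n * ∏ v, ((liftFree σ π X v).card.choose b : ℝ) ≤
        liftWeight σ π x y X := fun X hX => by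
    have hleft : x ^ ∑ u, (X u).card = (x ^ a) ^ n := by
      simp [mem_uniformFibers.1 hX, ← pow_mul, mul_comm]
    have hright : (y ^ b) ^ n * ∏ v, ((liftFree σ π X v).card.choose b : ℝ) =
        ∏ v, y ^ b * ((liftFree σ π X v).card.choose b : ℝ) := by
      simp [Finset.prod_mul_distrib]
    rw [liftWeight, hleft, mul_pow, mul_assoc, hright, ← Finset.prod_pow_eq_pow_sum]
    gcongr
    exact pow_mul_choose_le_one_add_pow hy.le _ _
  rw [card_liftPairs]
  push_cast
  rw [Finset.mul_sum]
  exact (Finset.sum_le_sum hterm).trans (Finset.sum_le_sum_of_subset_of_nonneg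
    (Finset.subset_univ _) fun X _ _ => (liftWeight_pos σ π hx hy X).le)

lemma card_lifts_indep {a b : ℕ} {X B : Fin n → Finset (Fin M)}
    (hX : X ∈ uniformFibers n M a) (hB : B ∈ uniformFibers n M b) :
    (({π | ∀ k u, ∀ j ∈ X u, π k u j ∉ B (σ k u)} :
        Finset (Fin d → Fin n → Equiv.Perm (Fin M))).card : ℝ) =
      Fintype.card (Fin d → Fin n → Equiv.Perm (Fin M)) * (avoidProb M a b ^ d) ^ n := by
  have hpi : ({π | ∀ k u, ∀ j ∈ X u, π k u j ∉ B (σ k u)} :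
      Finset (Fin d → Fin n → Equiv.Perm (Fin M))) =
      Fintype.piFinset fun k => Fintype.piFinset fun u => avoidingPerms (X u) (B (σ k u)) := by
    ext π
    simp [avoidingPerms]
  rw [hpi]
  simp only [Fintype.card_piFinset, Nat.cast_prod, card_avoidingPerms, mem_uniformFibers.1 hX,
    mem_uniformFibers.1 hB, Finset.prod_const, Finset.card_univ, Fintype.card_fin,
    Fintype.card_pi_const, Fintype.card_perm, Nat.cast_pow]
  ring

lemma sum_card_liftPairs (M a b : ℕ) :
    ∑ π : Fin d → Fin n → Equiv.Perm (Fin M), ((liftPairs σ π a b).card : ℝ) =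
      Fintype.card (Fin d → Fin n → Equiv.Perm (Fin M)) * expectedPairs d M a b ^ n := by
  have hcount := Finset.sum_card_bipartiteAbove_eq_sum_card_bipartiteBelow
    (s := uniformFibers n M a ×ˢ uniformFibers n M b)
    (t := (Finset.univ : Finset (Fin d → Fin n → Equiv.Perm (Fin M))))
    fun p π => ∀ k u, ∀ j ∈ p.1 u, π k u j ∉ p.2 (σ k u)
  calc ∑ π : Fin d → Fin n → Equiv.Perm (Fin M), ((liftPairs σ π a b).card : ℝ)
      = ∑ p ∈ uniformFibers n M a ×ˢ uniformFibers n M b,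
          (({π | ∀ k u, ∀ j ∈ p.1 u, π k u j ∉ p.2 (σ k u)} :
            Finset (Fin d → Fin n → Equiv.Perm (Fin M))).card : ℝ) := by
        exact_mod_cast hcount.symm
    _ = ∑ _p ∈ uniformFibers n M a ×ˢ uniformFibers n M b,
          Fintype.card (Fin d → Fin n → Equiv.Perm (Fin M)) * (avoidProb M a b ^ d) ^ n :=
        Finset.sum_congr rfl fun p hp => card_lifts_indep σ (Finset.mem_product.1 hp).1
          (Finset.mem_product.1 hp).2
    _ = _ := by
        rw [Finset.sum_const, Finset.card_product, card_uniformFibers, card_uniformFibers,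
          nsmul_eq_mul, expectedPairs]
        push_cast
        ring

theorem expectedPairs_pow_le_pairZ_pow (hd : 0 < d) (hx : 0 < x) (hy : 0 < y) (M a b : ℕ) :
    (x ^ a * y ^ b * expectedPairs d M a b) ^ n ≤ pairZ σ x y ^ M := by
  set N : ℝ := (Fintype.card (Fin d → Fin n → Equiv.Perm (Fin M)) : ℝ)
  have hNpos : 0 < N := Nat.cast_pos.2 Fintype.card_pos
  refine le_of_mul_le_mul_left ?_ hNpos
  calc N * (x ^ a * y ^ b * expectedPairs d M a b) ^ n
      = ∑ π : Fin d → Fin n → Equiv.Perm (Fin M),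
          (x ^ a * y ^ b) ^ n * ((liftPairs σ π a b).card : ℝ) := by
        rw [← Finset.mul_sum, sum_card_liftPairs]
        ring
    _ ≤ ∑ _π : Fin d → Fin n → Equiv.Perm (Fin M), pairZ σ x y ^ M :=
        Finset.sum_le_sum fun π _ => (pow_mul_card_liftPairs_le σ π hx hy a b).trans
          (sum_liftWeight_le σ π hd hx hy)
    _ = N * pairZ σ x y ^ M := by rw [Finset.sum_const, nsmul_eq_mul, Finset.card_univ]

end Lift

/-! ### The exponential rate -/

section Rate

/-- The error `log k! - (k log k - k)` of the leading term of Stirling's formula. -/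
def stirlingError (k : ℕ) : ℝ := Real.log k.factorial - (k * Real.log k - k)

lemma stirlingError_nonneg (k : ℕ) : 0 ≤ stirlingError k := by
  rcases eq_or_ne k 0 with rfl | hk
  · simp [stirlingError]
  · have hstirling := Stirling.le_log_factorial_stirling hk
    have hlogk := Real.log_natCast_nonneg k
    have hlogpi : 0 ≤ Real.log (2 * Real.pi) := Real.log_nonneg (by linarith [Real.two_le_pi])
    rw [stirlingError]
    linarith

lemma stirlingError_le (k : ℕ) : stirlingError k ≤ Real.log k + 1 := by
  rcases k with _ | k
  · simp [stirlingError]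
  · have hseq : Real.log (Stirling.stirlingSeq (k + 1)) ≤ Real.log (Stirling.stirlingSeq 1) :=
      Stirling.log_stirlingSeq'_antitone k.zero_le
    rw [Stirling.log_stirlingSeq_formula, Stirling.stirlingSeq_one,
      Real.log_div (Real.exp_pos _).ne' (by positivity), Real.log_sqrt two_pos.le, Real.log_exp,
      Real.log_mul two_ne_zero (by positivity), Real.log_div (by positivity) (Real.exp_pos _).ne',
      Real.log_exp] at hseq
    have hlogk := Real.log_natCast_nonneg (k + 1)
    rw [stirlingError]
    linarith

lemma stirlingError_mem_Icc {k n : ℕ} (h : k ≤ n) :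
    stirlingError k ∈ Set.Icc 0 (Real.log (n + 1) + 1) := by
  have hlog : Real.log k ≤ Real.log (n + 1) := by
    rcases k.eq_zero_or_pos with rfl | hk
    · simpa using Real.log_natCast_nonneg (n + 1)
    · exact Real.log_le_log (by positivity) (by exact_mod_cast h.trans n.le_succ)
  exact ⟨stirlingError_nonneg k, (stirlingError_le k).trans (by linarith)⟩

/-- The exponential rate of the expected weight of the independent sets with densities `α` on the
left and `β` on the right, for activities `x` on the left and `y` on the right. -/
def rate (d : ℕ) (x y α β : ℝ) : ℝ :=
  α * Real.log x + β * Real.log y + Real.negMulLog α + Real.negMulLog β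
    - ((d : ℝ) - 1) * (Real.negMulLog (1 - α) + Real.negMulLog (1 - β))
    + d * Real.negMulLog (1 - α - β)

lemma continuous_rate (d : ℕ) (x y : ℝ) : Continuous fun p : ℝ × ℝ => rate d x y p.1 p.2 := by
  have := Real.continuous_negMulLog
  unfold rate
  fun_prop

lemma rate_comm (d : ℕ) (x y α β : ℝ) : rate d x y α β = rate d y x β α := by
  rw [rate, rate, sub_right_comm 1 α β]
  ring

lemma mul_negMulLog_div {n : ℝ} (hn : n ≠ 0) (k : ℝ) :
    n * Real.negMulLog (k / n) = k * Real.log n - k * Real.log k := by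
  rcases eq_or_ne k 0 with rfl | hk
  · simp
  · rw [Real.negMulLog, Real.log_div hk hn]
    field_simp
    ring

lemma expectedPairs_pos (d : ℕ) {n a b : ℕ} (h : a + b ≤ n) : 0 < expectedPairs d n a b := by
  have ha : 0 < n.choose a := Nat.choose_pos (by omega)
  have hb : 0 < n.choose b := Nat.choose_pos (by omega)
  have hba : 0 < (n - b).choose a := Nat.choose_pos (by omega)
  unfold expectedPairs avoidProb
  positivity

lemma log_choose {n a : ℕ} (h : a ≤ n) : Real.log (n.choose a) =
    Real.log n.factorial - Real.log a.factorial - Real.log (n - a).factorial := by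
  have hpos : 0 < n.choose a := Nat.choose_pos h
  rw [← Nat.choose_mul_factorial_mul_factorial h]
  push_cast
  rw [Real.log_mul (by positivity) (by positivity), Real.log_mul (by positivity) (by positivity)]
  ring

lemma log_expectedPairs (d : ℕ) {n a b : ℕ} (h : a + b ≤ n) :
    Real.log (expectedPairs d n a b) = Real.log (n.choose a) + Real.log (n.choose b)
      + d * (Real.log ((n - b).choose a) - Real.log (n.choose a)) := by
  have ha : 0 < n.choose a := Nat.choose_pos (by omega)
  have hb : 0 < n.choose b := Nat.choose_pos (by omega)
  have hba : 0 < (n - b).choose a := Nat.choose_pos (by omega)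
  rw [expectedPairs, avoidProb, Real.log_mul (by positivity) (by positivity),
    Real.log_mul (by positivity) (by positivity), Real.log_pow,
    Real.log_div (by positivity) (by positivity)]

lemma log_expectedPairs_sub_mul_rate (d : ℕ) {n a b : ℕ} (hn : n ≠ 0) (h : a + b ≤ n)
    (x y : ℝ) :
    a * Real.log x + b * Real.log y + Real.log (expectedPairs d n a b)
        - n * rate d x y (a / n) (b / n) =
      2 * stirlingError n - stirlingError a - stirlingError (n - a) - stirlingError b
        - stirlingError (n - b) + d * (stirlingError (n - b) + stirlingError (n - a)
          - stirlingError (n - a - b) - stirlingError n) := by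
  have hn' : (n : ℝ) ≠ 0 := Nat.cast_ne_zero.2 hn
  have hsub : ∀ t : ℝ, 1 - t / n = (n - t) / n := fun t => by rw [sub_div, div_self hn']
  have hrate : n * rate d x y (a / n) (b / n) = a * Real.log x + b * Real.log y
      + n * Real.negMulLog (a / n) + n * Real.negMulLog (b / n)
      - ((d : ℝ) - 1) * (n * Real.negMulLog ((n - a) / n) + n * Real.negMulLog ((n - b) / n))
      + d * (n * Real.negMulLog ((n - a - b) / n)) := by
    rw [rate, hsub, hsub, ← sub_div]
    field_simp
  simp only [mul_negMulLog_div hn'] at hrate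
  rw [hrate, log_expectedPairs d h, log_choose (by omega), log_choose (by omega),
    log_choose (show a ≤ n - b by omega), Nat.sub_right_comm n b a]
  simp only [stirlingError]
  rw [Nat.cast_sub (show b ≤ n - a by omega), Nat.cast_sub (show a ≤ n by omega),
    Nat.cast_sub (show b ≤ n by omega)]
  ring

lemma abs_log_expectedPairs_sub_le (d : ℕ) {n a b : ℕ} (hn : n ≠ 0) (h : a + b ≤ n) (x y : ℝ) :
    |a * Real.log x + b * Real.log y + Real.log (expectedPairs d n a b)
      - n * rate d x y (a / n) (b / n)| ≤ (4 + 2 * d) * (Real.log (n + 1) + 1) := by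
  rw [log_expectedPairs_sub_mul_rate d hn h]
  obtain ⟨l, u⟩ := stirlingError_mem_Icc (le_refl n)
  obtain ⟨la, ua⟩ := stirlingError_mem_Icc (show a ≤ n by omega)
  obtain ⟨la', ua'⟩ := stirlingError_mem_Icc (show n - a ≤ n by omega)
  obtain ⟨lb, ub⟩ := stirlingError_mem_Icc (show b ≤ n by omega)
  obtain ⟨lb', ub'⟩ := stirlingError_mem_Icc (show n - b ≤ n by omega)
  obtain ⟨lab, uab⟩ := stirlingError_mem_Icc (show n - a - b ≤ n by omega)
  set L := Real.log ((n : ℝ) + 1) + 1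
  have hinner : |stirlingError (n - b) + stirlingError (n - a) - stirlingError (n - a - b)
      - stirlingError n| ≤ 2 * L := abs_le.2 ⟨by linarith, by linarith⟩
  have houter : |2 * stirlingError n - stirlingError a - stirlingError (n - a)
      - stirlingError b - stirlingError (n - b)| ≤ 4 * L := abs_le.2 ⟨by linarith, by linarith⟩
  refine (abs_add_le _ _).trans ?_
  rw [abs_mul, Nat.abs_cast]
  linarith [mul_le_mul_of_nonneg_left hinner (Nat.cast_nonneg (α := ℝ) d)]

lemma tendsto_log_add_one_div (C : ℝ) :
    Tendsto (fun n : ℕ => C * (Real.log (n + 1) + 1) / n) atTop (𝓝 0) := by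
  have hlog : (fun n : ℕ => Real.log ((n : ℝ) + 1)) =o[atTop] fun n : ℕ => (n : ℝ) + 1 :=
    Real.isLittleO_log_id_atTop.comp_tendsto
      (tendsto_atTop_add_const_right _ _ tendsto_natCast_atTop_atTop)
  have hone : (fun _ : ℕ => (1 : ℝ)) =o[atTop] fun n : ℕ => (n : ℝ) :=
    isLittleO_const_left.2 (.inr (tendsto_abs_atTop_atTop.comp tendsto_natCast_atTop_atTop))
  have hsucc : (fun n : ℕ => (n : ℝ) + 1) =O[atTop] fun n : ℕ => (n : ℝ) :=
    (isBigO_refl _ _).add hone.isBigO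
  exact (((hlog.trans_isBigO hsucc).add hone).const_mul_left C).tendsto_div_nhds_zero

lemma pairZ_pos {n d : ℕ} (σ : Fin d → Equiv.Perm (Fin n)) {x y : ℝ} (hx : 0 < x) (hy : 0 < y) :
    0 < pairZ σ x y := by
  rw [← sum_leftWeight]
  exact Finset.sum_pos (fun A _ => leftWeight_pos σ hx hy A) Finset.univ_nonempty

lemma mul_rate_div_sub_le_log_pairZ {n d : ℕ} (σ : Fin d → Equiv.Perm (Fin n)) (hd : 0 < d)
    {x y : ℝ} (hx : 0 < x) (hy : 0 < y) {M a b : ℕ} (hM : M ≠ 0) (hab : a + b ≤ M) :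
    n * (rate d x y (a / M) (b / M) - (4 + 2 * d) * (Real.log (M + 1) + 1) / M) ≤
      Real.log (pairZ σ x y) := by
  have hE := expectedPairs_pos d hab
  have hlift := Real.log_le_log (by positivity) (expectedPairs_pow_le_pairZ_pow σ hd hx hy M a b)
  rw [Real.log_pow, Real.log_pow, Real.log_mul (by positivity) hE.ne',
    Real.log_mul (by positivity) (by positivity), Real.log_pow, Real.log_pow] at hlift
  have hstirling := (abs_le.1 (abs_log_expectedPairs_sub_le d hM hab x y)).1
  have hM' : (0 : ℝ) < M := by positivity
  refine le_of_mul_le_mul_left ?_ hM'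
  calc (M : ℝ) * (n * (rate d x y (a / M) (b / M) - (4 + 2 * d) * (Real.log (M + 1) + 1) / M))
      = n * (M * rate d x y (a / M) (b / M) - (4 + 2 * d) * (Real.log (M + 1) + 1)) := by
        field_simp
    _ ≤ n * (a * Real.log x + b * Real.log y + Real.log (expectedPairs d M a b)) := by
        gcongr
        linarith
    _ ≤ M * Real.log (pairZ σ x y) := hlift

/-- The admissible pairs of densities. -/
def densities : Set (ℝ × ℝ) := {p | 0 ≤ p.1 ∧ 0 ≤ p.2 ∧ p.1 + p.2 ≤ 1}

theorem exp_rate_le_pairZ {n d : ℕ} (σ : Fin d → Equiv.Perm (Fin n)) (hd : 0 < d) {x y : ℝ}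
    (hx : 0 < x) (hy : 0 < y) {p : ℝ × ℝ} (hp : p ∈ densities) :
    Real.exp (n * rate d x y p.1 p.2) ≤ pairZ σ x y := by
  obtain ⟨h1, h2, h12⟩ := hp
  rw [← Real.le_log_iff_exp_le (pairZ_pos σ hx hy)]
  have hfloor : ∀ γ : ℝ, 0 ≤ γ →
      Tendsto (fun M : ℕ => (⌊γ * M⌋₊ : ℝ) / M) atTop (𝓝 γ) := fun γ hγ =>
    (tendsto_nat_floor_mul_div_atTop hγ).comp (tendsto_natCast_atTop_atTop (R := ℝ))
  have hrate : Tendsto (fun M : ℕ => rate d x y (⌊p.1 * M⌋₊ / M) (⌊p.2 * M⌋₊ / M))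
      atTop (𝓝 (rate d x y p.1 p.2)) :=
    Tendsto.comp (g := fun q : ℝ × ℝ => rate d x y q.1 q.2)
      (f := fun M : ℕ => ((⌊p.1 * M⌋₊ : ℝ) / M, (⌊p.2 * M⌋₊ : ℝ) / M))
      ((continuous_rate d x y).tendsto p) ((hfloor _ h1).prodMk_nhds (hfloor _ h2))
  have hlim := (hrate.sub (tendsto_log_add_one_div (4 + 2 * d))).const_mul (n : ℝ)
  rw [sub_zero] at hlim
  refine le_of_tendsto hlim ?_
  filter_upwards [eventually_ne_atTop 0] with M hM
  refine mul_rate_div_sub_le_log_pairZ σ hd hx hy hM ?_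
  have hsum : (⌊p.1 * M⌋₊ : ℝ) + ⌊p.2 * M⌋₊ ≤ M :=
    calc (⌊p.1 * M⌋₊ : ℝ) + ⌊p.2 * M⌋₊ ≤ p.1 * M + p.2 * M :=
          add_le_add (Nat.floor_le (by positivity)) (Nat.floor_le (by positivity))
      _ ≤ M := by rw [← add_mul]; exact mul_le_of_le_one_left M.cast_nonneg h12
  exact_mod_cast hsum

end Rate

section Gap

lemma isCompact_densities : IsCompact densities := by
  have hsub : densities ⊆ Set.Icc (0 : ℝ) 1 ×ˢ Set.Icc (0 : ℝ) 1 := fun p ⟨h1, h2, h12⟩ =>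
    ⟨⟨h1, by linarith⟩, ⟨h2, by linarith⟩⟩
  refine (isCompact_Icc.prod isCompact_Icc).of_isClosed_subset ?_ hsub
  exact (isClosed_le continuous_const continuous_fst).inter
    ((isClosed_le continuous_const continuous_snd).inter
      (isClosed_le (continuous_fst.add continuous_snd) continuous_const))

lemma zero_mem_densities : (0, 0) ∈ densities := ⟨le_rfl, le_rfl, by norm_num⟩

lemma swap_mem_densities {p : ℝ × ℝ} (hp : p ∈ densities) : p.swap ∈ densities :=
  ⟨hp.2.1, hp.1, (add_comm _ _).trans_le hp.2.2⟩

lemma lamCrit_pos {d : ℕ} (hd : 3 ≤ d) : 0 < lamCrit d := by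
  have hd' : (3 : ℝ) ≤ d := by exact_mod_cast hd
  have h1 : (0 : ℝ) < (d : ℝ) - 1 := by linarith
  have h2 : (0 : ℝ) < (d : ℝ) - 2 := by linarith
  unfold lamCrit
  positivity

variable {d : ℕ} {lam α : ℝ}

lemma rate_left_only (d : ℕ) (hlam : 0 < lam) (y : ℝ) :
    rate d lam y (lam / (1 + lam)) 0 = Real.log (1 + lam) := by
  have hfrac : 1 - lam / (1 + lam) = 1 / (1 + lam) := by
    field_simp
    ring
  have hpos : 0 < 1 + lam := by linarith
  rw [rate, sub_zero, sub_zero, hfrac]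
  simp only [Real.negMulLog, Real.log_one, Real.log_zero]
  rw [Real.log_div hlam.ne' hpos.ne', Real.log_div one_ne_zero hpos.ne', Real.log_one]
  field_simp
  ring

lemma rate_zero_zero (d : ℕ) (x y : ℝ) : rate d x y 0 0 = 0 := by
  simp [rate]

lemma rate_half_half (d : ℕ) (lam : ℝ) :
    rate d lam lam (1 / 2) (1 / 2) = Real.log lam - ((d : ℝ) - 2) * Real.log 2 := by
  have hhalf : Real.negMulLog (1 / 2) = 1 / 2 * Real.log 2 := by
    rw [Real.negMulLog, one_div, Real.log_inv]
    ring
  rw [rate, sub_half, sub_self, hhalf, Real.negMulLog_zero]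
  ring

lemma hasDerivAt_negMulLog_comp {f : ℝ → ℝ} {f' t : ℝ} (hf : HasDerivAt f f' t) (h : f t ≠ 0) :
    HasDerivAt (fun s => Real.negMulLog (f s)) ((-Real.log (f t) - 1) * f') t :=
  (Real.hasDerivAt_negMulLog h).comp t hf

lemma hasDerivAt_rate_diagonal (d : ℕ) (lam : ℝ) (h0 : 0 < α) (h1 : α < 1 / 2) :
    HasDerivAt (fun t => rate d lam lam t t)
      (2 * (Real.log lam - Real.log α - ((d : ℝ) - 1) * Real.log (1 - α)
        + d * Real.log (1 - α - α))) α := by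
  have hid := hasDerivAt_id' α
  have hocc := hasDerivAt_negMulLog_comp hid h0.ne'
  have hunocc := hasDerivAt_negMulLog_comp (hid.const_sub 1) (by linarith : (1 : ℝ) - α ≠ 0)
  have hboth := hasDerivAt_negMulLog_comp ((hid.const_sub 1).sub hid)
    (show (1 : ℝ) - α - α ≠ 0 by intro h; linarith)
  have hact := hid.mul_const (Real.log lam)
  refine (((((hact.add hact).add hocc).add hocc).sub
    ((hunocc.add hunocc).const_mul ((d : ℝ) - 1))).add (hboth.const_mul (d : ℝ))).congr_deriv ?_
  simp only [Pi.sub_apply]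
  ring

lemma log_le_log_lamCrit (hd : 3 ≤ d) (h0 : 0 < α) (hα : α * d ≤ 1) :
    Real.log α + ((d : ℝ) - 1) * Real.log (1 - α) - d * Real.log (1 - α - α)
      ≤ Real.log (lamCrit d) := by
  have hd' : (3 : ℝ) ≤ d := by exact_mod_cast hd
  have hα3 : α * 3 ≤ 1 := (mul_le_mul_of_nonneg_left hd' h0.le).trans hα
  have hd1 : 0 < (d : ℝ) - 1 := by linarith
  have hd2 : 0 < (d : ℝ) - 2 := by linarith
  have hα1 : 0 < 1 - α := by linarith
  have hα2 : 0 < 1 - α - α := by linarith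
  have hocc : Real.log (α * (d - 2)) ≤ Real.log (1 - α - α) :=
    Real.log_le_log (by positivity) (by linarith)
  have hunocc : Real.log ((1 - α) * (d - 2)) ≤ Real.log ((d - 1) * (1 - α - α)) :=
    Real.log_le_log (by positivity) (by linarith)
  rw [Real.log_mul h0.ne' hd2.ne'] at hocc
  rw [Real.log_mul hα1.ne' hd2.ne', Real.log_mul hd1.ne' hα2.ne'] at hunocc
  rw [lamCrit, Real.log_div (by positivity) (by positivity), Real.log_pow, Real.log_pow,
    Nat.cast_pred (by omega)]
  linarith [mul_le_mul_of_nonneg_left hunocc hd1.le]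

/-- The derivative of the rate along the antidiagonal through `(α, α)`. -/
def antidiagonalDeriv (d : ℕ) (α t : ℝ) : ℝ :=
  Real.log (α - t) - Real.log (α + t) -
    ((d : ℝ) - 1) * (Real.log (1 - (α + t)) - Real.log (1 - (α - t)))

lemma hasDerivAt_rate_antidiagonal (d : ℕ) (lam : ℝ) {t : ℝ} (h1 : α + t ∈ Set.Ioo 0 1)
    (h2 : α - t ∈ Set.Ioo 0 1) :
    HasDerivAt (fun t => rate d lam lam (α + t) (α - t)) (antidiagonalDeriv d α t) t := by
  have ha := (hasDerivAt_id' t).const_add α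
  have hb := (hasDerivAt_id' t).const_sub α
  have hocc := (hasDerivAt_negMulLog_comp ha h1.1.ne').add (hasDerivAt_negMulLog_comp hb h2.1.ne')
  have hunocc := (hasDerivAt_negMulLog_comp (ha.const_sub 1) (sub_pos.2 h1.2).ne').add
    (hasDerivAt_negMulLog_comp (hb.const_sub 1) (sub_pos.2 h2.2).ne')
  have hact := (ha.mul_const (Real.log lam)).add (hb.mul_const (Real.log lam))
  refine (((hact.add hocc).sub (hunocc.const_mul ((d : ℝ) - 1))).add_const
    (d * Real.negMulLog (1 - α - α))).congr_deriv ?_ |>.congr_of_eventuallyEq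
      (Eventually.of_forall fun s => ?_)
  · rw [antidiagonalDeriv]
    ring
  · have hsum : 1 - (α + s) - (α - s) = 1 - α - α := by ring
    simp only [rate, hsum, Pi.add_apply, Pi.sub_apply]
    ring

lemma hasDerivAt_antidiagonalDeriv (d : ℕ) (h0 : 0 < α) (h1 : α < 1) :
    HasDerivAt (antidiagonalDeriv d α) (2 * (α * d - 1) / (α * (1 - α))) 0 := by
  have hα1 : 0 < 1 - α := by linarith
  have ha := (hasDerivAt_id' (0 : ℝ)).const_add α
  have hb := (hasDerivAt_id' (0 : ℝ)).const_sub α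
  have hocc := (hb.log (by simpa using h0.ne')).sub (ha.log (by simpa using h0.ne'))
  have hunocc := ((ha.const_sub 1).log (by simpa using hα1.ne')).sub
    ((hb.const_sub 1).log (by simpa using hα1.ne'))
  refine (hocc.sub (hunocc.const_mul ((d : ℝ) - 1))).congr_deriv ?_
  simp only [sub_zero, add_zero]
  field_simp
  ring

lemma exists_gt_of_hasDerivAt_deriv_pos {f f' : ℝ → ℝ} {a c : ℝ}
    (hf : ∀ᶠ t in 𝓝 a, HasDerivAt f (f' t) t) (ha : f' a = 0) (hf' : HasDerivAt f' c a)
    (hc : 0 < c) {s : Set ℝ} (hs : s ∈ 𝓝 a) : ∃ t ∈ s, f a < f t := by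
  by_contra! hle
  have hderiv : deriv f =ᶠ[𝓝 a] f' := hf.mono fun t ht => ht.deriv
  have hderiv2 : deriv (deriv f) a = c := hderiv.deriv_eq.trans hf'.deriv
  have hmin : IsLocalMin f a := isLocalMin_of_deriv_deriv_pos (hderiv2 ▸ hc)
    (hderiv.self_of_nhds.trans ha) hf.self_of_nhds.continuousAt
  have hconst : f =ᶠ[𝓝 a] fun _ => f a := by
    filter_upwards [hs, hmin] with t ht htmin
    exact le_antisymm (hle t ht) htmin
  have hzero : deriv (deriv f) a = 0 := by
    rw [hconst.deriv.deriv_eq]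
    simp
  exact hc.ne' (hderiv2.symm.trans hzero)

lemma exists_rate_antidiagonal_gt (d : ℕ) (lam : ℝ) (h0 : 0 < α) (h1 : α < 1 / 2)
    (hα : 1 < α * d) {s : Set ℝ} (hs : s ∈ 𝓝 (0 : ℝ)) :
    ∃ t ∈ s, rate d lam lam α α < rate d lam lam (α + t) (α - t) := by
  have hderiv : ∀ᶠ t in 𝓝 (0 : ℝ), HasDerivAt (fun t => rate d lam lam (α + t) (α - t))
      (antidiagonalDeriv d α t) t := by
    filter_upwards [Ioo_mem_nhds (neg_neg_of_pos h0) h0] with t ht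
    exact hasDerivAt_rate_antidiagonal d lam ⟨by linarith [ht.1], by linarith [ht.2]⟩
      ⟨by linarith [ht.2], by linarith [ht.1]⟩
  have hpos : 0 < 2 * (α * d - 1) / (α * (1 - α)) :=
    div_pos (by linarith) (mul_pos h0 (by linarith))
  simpa using exists_gt_of_hasDerivAt_deriv_pos hderiv (by simp [antidiagonalDeriv])
    (hasDerivAt_antidiagonalDeriv d h0 (by linarith)) hpos hs

lemma exists_rate_gt_of_interior (hd : 3 ≤ d) (hl : lamCrit d < lam) (h0 : 0 < α)
    (h1 : α < 1 / 2) : ∃ p ∈ densities, rate d lam lam α α < rate d lam lam p.1 p.2 := by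
  by_contra! hmax
  have hloc : IsLocalMax (fun t => rate d lam lam t t) α := by
    filter_upwards [Ioo_mem_nhds h0 h1] with t ht
    exact hmax (t, t) ⟨ht.1.le, ht.1.le, by linarith [ht.2]⟩
  have hcrit := hloc.hasDerivAt_eq_zero (hasDerivAt_rate_diagonal d lam h0 h1)
  -- At a critical point on the diagonal, `lam` is an increasing function of `α` which passes
  -- through `lamCrit d` at `α = 1 / d`.
  have hα : 1 < α * d := by
    by_contra! hle
    linarith [log_le_log_lamCrit hd h0 hle, Real.log_lt_log (lamCrit_pos hd) hl]
  obtain ⟨t, ht, hlt⟩ := exists_rate_antidiagonal_gt d lam h0 h1 hα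
    (Ioo_mem_nhds (neg_neg_of_pos h0) h0)
  exact absurd hlt (not_lt.2 (hmax (α + t, α - t)
    ⟨by linarith [ht.1], by linarith [ht.2], by linarith⟩))

lemma exists_rate_gt_diagonal (hd : 3 ≤ d) (hl : lamCrit d < lam) (hα : (α, α) ∈ densities) :
    ∃ p ∈ densities, rate d lam lam α α < rate d lam lam p.1 p.2 := by
  have hlam : 0 < lam := (lamCrit_pos hd).trans hl
  have hleft : (lam / (1 + lam), 0) ∈ densities :=
    ⟨by positivity, le_rfl, by rw [add_zero, div_le_one (by positivity)]; linarith⟩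
  have h0 : 0 ≤ α := hα.1
  have h1 : α ≤ 1 / 2 := by linarith [hα.2.2]
  rcases h0.eq_or_lt with rfl | h0
  · refine ⟨_, hleft, ?_⟩
    rw [rate_zero_zero, rate_left_only d hlam]
    exact Real.log_pos (by linarith)
  rcases h1.eq_or_lt with rfl | h1
  · refine ⟨_, hleft, ?_⟩
    rw [rate_half_half, rate_left_only d hlam]
    have hd' : (3 : ℝ) ≤ d := by exact_mod_cast hd
    linarith [Real.log_lt_log hlam (lt_one_add lam),
      mul_nonneg (by linarith : (0 : ℝ) ≤ d - 2) (Real.log_nonneg one_le_two)]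
  exact exists_rate_gt_of_interior hd hl h0 h1

theorem exists_rate_gap (hd : 3 ≤ d) (hl : lamCrit d < lam) :
    ∃ R ε : ℝ, 0 < ε ∧ (∀ p ∈ densities, rate d lam lam p.1 p.2 ≤ R) ∧
      (∀ p ∈ densities, |p.1 - p.2| < ε → rate d lam lam p.1 p.2 ≤ R - ε) ∧
      ∀ s : ℝ, |s| = 1 → ∃ p ∈ densities, R ≤ rate d lam lam p.1 p.2 ∧ ε ≤ s * (p.1 - p.2) := by
  have hcont := continuous_rate d lam lam
  obtain ⟨q, hq, hqmax⟩ := isCompact_densities.exists_isMaxOn ⟨_, zero_mem_densities⟩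
    hcont.continuousOn
  set R := rate d lam lam q.1 q.2
  have hpos : ∀ p ∈ densities, 0 < max |p.1 - p.2| (R - rate d lam lam p.1 p.2) := by
    rintro ⟨α, β⟩ hp
    rcases eq_or_ne α β with rfl | hne
    · obtain ⟨p', hp', hlt⟩ := exists_rate_gt_diagonal hd hl hp
      exact lt_max_of_lt_right (sub_pos.2 (hlt.trans_le (hqmax hp')))
    · exact lt_max_of_lt_left (abs_pos.2 (sub_ne_zero.2 hne))
  obtain ⟨ε, hε, hgap⟩ := isCompact_densities.exists_forall_le' (by fun_prop) hpos
  have hqε : ε ≤ |q.1 - q.2| := by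
    rcases le_max_iff.1 (hgap q hq) with h | h
    · exact h
    · linarith
  refine ⟨R, ε, hε, fun p hp => hqmax hp, fun p hp hpε => ?_, fun s hs => ?_⟩
  · rcases le_max_iff.1 (hgap p hp) with h | h <;> linarith
  · rw [← one_mul |q.1 - q.2|, ← hs, ← abs_mul] at hqε
    rcases le_total 0 (s * (q.1 - q.2)) with h | h
    · exact ⟨q, hq, le_rfl, by rwa [abs_of_nonneg h] at hqε⟩
    · refine ⟨q.swap, swap_mem_densities hq, (rate_comm d lam lam _ _).le, ?_⟩
      rw [abs_of_nonpos h] at hqε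
      simp only [Prod.fst_swap, Prod.snd_swap]
      linarith

end Gap

/-! ### Bottlenecks of reversible chains -/

section Bottleneck

variable {S : Type*} [Fintype S]

lemma sum_sub_le_tvDist {p q : S → ℝ} (h : ∑ x, p x = ∑ x, q x) (T : Finset S) :
    ∑ x ∈ T, (q x - p x) ≤ tvDist p q := by
  classical
  have hsum : ∑ x ∈ T, (q x - p x) + ∑ x ∈ Tᶜ, (q x - p x) = 0 := by
    rw [Finset.sum_add_sum_compl, Finset.sum_sub_distrib, h, sub_self]
  have habs : ∑ x ∈ T, |p x - q x| + ∑ x ∈ Tᶜ, |p x - q x| = ∑ x, |p x - q x| :=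
    Finset.sum_add_sum_compl _ _
  have hT : ∑ x ∈ T, (q x - p x) ≤ ∑ x ∈ T, |p x - q x| :=
    Finset.sum_le_sum fun x _ => (le_abs_self _).trans_eq (abs_sub_comm _ _)
  have hTc : -∑ x ∈ Tᶜ, (q x - p x) ≤ ∑ x ∈ Tᶜ, |p x - q x| := by
    rw [← Finset.sum_neg_distrib]
    exact Finset.sum_le_sum fun x _ => (neg_sub (q x) (p x)).trans_le (le_abs_self _)
  rw [tvDist]
  linarith

lemma one_div_four_le_sum_of_tvDist_le {p μ : S → ℝ} (h : ∑ x, p x = ∑ x, μ x)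
    {T : Finset S} (hT : 1 / 2 ≤ ∑ x ∈ T, μ x) (hp : tvDist p μ ≤ 1 / (2 * Real.exp 1)) :
    1 / 4 ≤ ∑ x ∈ T, p x := by
  have hexp : 1 / (2 * Real.exp 1) ≤ (1 : ℝ) / 4 :=
    one_div_le_one_div_of_le (by norm_num) (by linarith [Real.add_one_le_exp (1 : ℝ)])
  have hsub := sum_sub_le_tvDist h T
  rw [Finset.sum_sub_distrib] at hsub
  linarith

lemma exists_abs_eq_one_sum_le_half {μ : S → ℝ} (hμ : ∀ x, 0 ≤ μ x) (hμ1 : ∑ x, μ x = 1) (D : S → ℝ)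
    {ℓ : ℝ} (hℓ : 0 ≤ ℓ) : ∃ s : ℝ, |s| = 1 ∧ ∑ x with ℓ < s * D x, μ x ≤ 1 / 2 := by
  classical
  by_contra! hlarge
  have hdisj : Disjoint (Finset.univ.filter fun x => ℓ < 1 * D x)
      (Finset.univ.filter fun x => ℓ < -1 * D x) :=
    Finset.disjoint_filter.2 fun x _ hpos hneg => by linarith
  have hsum : ∑ x with ℓ < 1 * D x, μ x + ∑ x with ℓ < -1 * D x, μ x ≤ 1 := by
    rw [← Finset.sum_union hdisj, ← hμ1]
    exact Finset.sum_le_univ_sum_of_nonneg hμ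
  linarith [hlarge 1 (by simp), hlarge (-1) (by simp)]

variable [DecidableEq S] {P Q : Matrix S S ℝ} {μ : S → ℝ}

/-- The probability that a chain with transition matrix `P` started from the distribution `μ` is
in `A` at time `0` and outside `A` at time `1`. -/
def ergodicFlow (P : Matrix S S ℝ) (μ : S → ℝ) (A : Finset S) : ℝ :=
  ∑ x ∈ A, ∑ y ∈ Aᶜ, μ x * P x y

lemma ergodicFlow_one (μ : S → ℝ) (A : Finset S) : ergodicFlow 1 μ A = 0 :=
  Finset.sum_eq_zero fun x hx => Finset.sum_eq_zero fun y hy => by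
    rw [Matrix.one_apply_ne (ne_of_mem_of_not_mem hx (Finset.mem_compl.1 hy)), mul_zero]

lemma sum_mul_le_of_mem_rowStochastic (hP : P ∈ Matrix.rowStochastic ℝ S) {c : ℝ} (hc : 0 ≤ c)
    (A : Finset S) (x : S) : ∑ y ∈ A, c * P x y ≤ c := by
  rw [← Finset.mul_sum]
  refine mul_le_of_le_one_right hc ?_
  rw [← Matrix.sum_row_of_mem_rowStochastic hP x]
  exact Finset.sum_le_univ_sum_of_nonneg fun y => Matrix.nonneg_of_mem_rowStochastic hP

-- Leaving `A` within two steps requires leaving it at one of them; the law before the second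
-- step, restricted to `A`, is at most `μ`.
lemma ergodicFlow_mul_le (hP : P ∈ Matrix.rowStochastic ℝ S) (hQ : Q ∈ Matrix.rowStochastic ℝ S)
    (hμ : ∀ x, 0 ≤ μ x) (hμP : ∀ y, ∑ x, μ x * P x y = μ y) (A : Finset S) :
    ergodicFlow (P * Q) μ A ≤ ergodicFlow P μ A + ergodicFlow Q μ A := by
  have hP0 : ∀ x y, 0 ≤ P x y := fun x y => Matrix.nonneg_of_mem_rowStochastic hP
  have hQ0 : ∀ x y, 0 ≤ Q x y := fun x y => Matrix.nonneg_of_mem_rowStochastic hQ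
  have hout : ∑ x ∈ A, ∑ z ∈ Aᶜ, ∑ y ∈ Aᶜ, μ x * P x z * Q z y ≤ ergodicFlow P μ A :=
    Finset.sum_le_sum fun x _ => Finset.sum_le_sum fun z _ =>
      sum_mul_le_of_mem_rowStochastic hQ (mul_nonneg (hμ x) (hP0 x z)) Aᶜ z
  have hin : ∑ z ∈ A, ∑ y ∈ Aᶜ, (∑ x ∈ A, μ x * P x z) * Q z y ≤ ergodicFlow Q μ A := by
    refine Finset.sum_le_sum fun z _ => Finset.sum_le_sum fun y _ => ?_
    refine mul_le_mul_of_nonneg_right ?_ (hQ0 z y)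
    rw [← hμP z]
    exact Finset.sum_le_univ_sum_of_nonneg fun x => mul_nonneg (hμ x) (hP0 x z)
  calc ergodicFlow (P * Q) μ A
      = ∑ x ∈ A, ∑ z, ∑ y ∈ Aᶜ, μ x * P x z * Q z y := by
        refine Finset.sum_congr rfl fun x _ => ?_
        rw [Finset.sum_comm]
        simp only [Matrix.mul_apply, Finset.mul_sum, mul_assoc]
    _ = ∑ x ∈ A, ∑ z ∈ Aᶜ, ∑ y ∈ Aᶜ, μ x * P x z * Q z y +
          ∑ z ∈ A, ∑ y ∈ Aᶜ, (∑ x ∈ A, μ x * P x z) * Q z y := by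
        simp only [Finset.sum_mul, ← Finset.sum_compl_add_sum A, Finset.sum_add_distrib]
        rw [Finset.sum_comm (s := A) (t := A)]
        simp only [Finset.sum_comm (s := A) (t := Aᶜ)]
    _ ≤ ergodicFlow P μ A + ergodicFlow Q μ A := add_le_add hout hin

lemma ergodicFlow_pow_le (hP : P ∈ Matrix.rowStochastic ℝ S) (hμ : ∀ x, 0 ≤ μ x)
    (hμP : ∀ y, ∑ x, μ x * P x y = μ y) (A : Finset S) (t : ℕ) :
    ergodicFlow (P ^ t) μ A ≤ t * ergodicFlow P μ A := by
  induction t with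
  | zero => simp [ergodicFlow_one]
  | succ t ih =>
    rw [pow_succ']
    refine (ergodicFlow_mul_le hP (pow_mem hP t) hμ hμP A).trans ?_
    push_cast
    linarith

lemma IsReversibleChain.sum_mul_eq (hP : IsReversibleChain P μ) (y : S) :
    ∑ x, μ x * P x y = μ y := by
  rw [Finset.sum_congr rfl fun x _ => hP.2 x y, ← Finset.mul_sum,
    Matrix.sum_row_of_mem_rowStochastic hP.1, mul_one]

lemma IsReversibleChain.ergodicFlow_le (hP : IsReversibleChain P μ) (hμ : ∀ x, 0 ≤ μ x)
    {A N : Finset S} (hAN : ∀ x ∈ A, ∀ y ∉ A, P x y ≠ 0 → y ∈ N) :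
    ergodicFlow P μ A ≤ ∑ y ∈ N, μ y :=
  have hP0 : ∀ x y, 0 ≤ P x y := fun x y => Matrix.nonneg_of_mem_rowStochastic hP.1
  calc ergodicFlow P μ A ≤ ∑ x ∈ A, ∑ y ∈ N, μ x * P x y := by
        refine Finset.sum_le_sum fun x hx => ?_
        rw [← Finset.sum_filter_ne_zero (s := Aᶜ)]
        refine Finset.sum_le_sum_of_subset_of_nonneg (fun y hy => ?_)
          fun y _ _ => mul_nonneg (hμ x) (hP0 x y)
        rw [Finset.mem_filter, Finset.mem_compl] at hy
        exact hAN x hx y hy.1 (right_ne_zero_of_mul hy.2)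
    _ = ∑ y ∈ N, ∑ x ∈ A, μ y * P y x := by
        rw [Finset.sum_comm]
        exact Finset.sum_congr rfl fun y _ => Finset.sum_congr rfl fun x _ => hP.2 x y
    _ ≤ ∑ y ∈ N, μ y :=
        Finset.sum_le_sum fun y _ => sum_mul_le_of_mem_rowStochastic hP.1 (hμ y) A y

theorem IsReversibleChain.sum_div_four_le_of_tvDist_le (hP : IsReversibleChain P μ)
    (hμ : ∀ x, 0 ≤ μ x) (hμ1 : ∑ x, μ x = 1) {A N : Finset S} (hA : ∑ x ∈ A, μ x ≤ 1 / 2)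
    (hAN : ∀ x ∈ A, ∀ y ∉ A, P x y ≠ 0 → y ∈ N) {t : ℕ}
    (ht : ∀ x, tvDist ((P ^ t) x) μ ≤ 1 / (2 * Real.exp 1)) :
    (∑ x ∈ A, μ x) / 4 ≤ t * ∑ x ∈ N, μ x := by
  have hAc : 1 / 2 ≤ ∑ y ∈ Aᶜ, μ y := by
    linarith [Finset.sum_add_sum_compl A μ]
  have hleave : ∀ x, 1 / 4 ≤ ∑ y ∈ Aᶜ, (P ^ t) x y := fun x =>
    one_div_four_le_sum_of_tvDist_le
      ((Matrix.sum_row_of_mem_rowStochastic (pow_mem hP.1 t) x).trans hμ1.symm) hAc (ht x)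
  calc (∑ x ∈ A, μ x) / 4 = ∑ x ∈ A, μ x * (1 / 4) := by
        rw [← Finset.sum_mul]
        ring
    _ ≤ ergodicFlow (P ^ t) μ A := Finset.sum_le_sum fun x _ => by
        rw [← Finset.mul_sum]
        exact mul_le_mul_of_nonneg_left (hleave x) (hμ x)
    _ ≤ t * ergodicFlow P μ A := ergodicFlow_pow_le hP.1 hμ hP.sum_mul_eq A t
    _ ≤ t * ∑ x ∈ N, μ x := by gcongr; exact hP.ergodicFlow_le hμ hAN

lemma ofReal_le_mixingTime {r : ℝ}
    (h : ∀ t : ℕ, (∀ x, tvDist ((P ^ t) x) μ ≤ 1 / (2 * Real.exp 1)) → r ≤ t) :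
    ENNReal.ofReal r ≤ (mixingTime P μ : ENNReal) := by
  have hceil : ((⌈r⌉₊ : ℕ) : ℕ∞) ≤ mixingTime P μ :=
    le_iInf₂ fun t ht => by exact_mod_cast Nat.ceil_le.2 (h t ht)
  calc ENNReal.ofReal r ≤ ENNReal.ofReal (⌈r⌉₊ : ℝ) := ENNReal.ofReal_le_ofReal (Nat.le_ceil r)
    _ = ((⌈r⌉₊ : ℕ∞) : ENNReal) := by simp
    _ ≤ mixingTime P μ := by exact_mod_cast hceil

lemma abs_le_of_abs_sub_le {s u v ℓ : ℝ} (hs : |s| = 1) (huv : |u - v| ≤ ℓ) (hu : ℓ < s * u)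
    (hv : s * v ≤ ℓ) : |v| ≤ ℓ := by
  rw [abs_le] at huv ⊢
  rcases (abs_eq zero_le_one).1 hs with rfl | rfl <;> constructor <;> linarith

theorem IsReversibleChain.ofReal_div_four_le_mixingTime (hP : IsReversibleChain P μ)
    (hμ : ∀ x, 0 ≤ μ x) (hμ1 : ∑ x, μ x = 1) {D : S → ℝ} {ℓ w b : ℝ} (hℓ : 0 ≤ ℓ) (hw : 0 < w)
    (hb : 0 ≤ b) (hD : ∀ x y, P x y ≠ 0 → |D x - D y| ≤ ℓ)
    (hside : ∀ s : ℝ, |s| = 1 → w ≤ ∑ x with ℓ < s * D x, μ x)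
    (hmiddle : b * ∑ x with |D x| ≤ ℓ, μ x ≤ w) :
    ENNReal.ofReal (b / 4) ≤ (mixingTime P μ : ENNReal) := by
  obtain ⟨s, hs, hhalf⟩ := exists_abs_eq_one_sum_le_half hμ hμ1 D hℓ
  set A : Finset S := Finset.univ.filter fun x => ℓ < s * D x
  set N : Finset S := Finset.univ.filter fun x => |D x| ≤ ℓ
  have hAN : ∀ x ∈ A, ∀ y ∉ A, P x y ≠ 0 → y ∈ N := by
    intro x hx y hy hxy
    simp only [A, N, Finset.mem_filter_univ, not_lt] at hx hy ⊢
    exact abs_le_of_abs_sub_le hs (hD x y hxy) hx hy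
  refine ofReal_le_mixingTime fun t ht => le_of_mul_le_mul_right ?_ (hw.trans_le (hside s hs))
  calc b / 4 * ∑ x ∈ A, μ x = b * ((∑ x ∈ A, μ x) / 4) := by ring
    _ ≤ b * (t * ∑ x ∈ N, μ x) := by
        gcongr
        exact hP.sum_div_four_le_of_tvDist_le hμ hμ1 hhalf hAN ht
    _ = t * (b * ∑ x ∈ N, μ x) := by ring
    _ ≤ t * ∑ x ∈ A, μ x := by
        gcongr
        exact hmiddle.trans (hside s hs)

end Bottleneck

/-! ### The Glauber dynamics -/

section Glauber

variable {V : Type*} {G : SimpleGraph V}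

lemma isIndepSet_insert [DecidableEq V] {I : Finset V} (hI : G.IsIndepSet (I : Set V)) {v : V}
    (hv : ∀ w, G.Adj v w → w ∉ I) : G.IsIndepSet ((insert v I : Finset V) : Set V) := by
  rw [Finset.coe_insert, SimpleGraph.IsIndepSet, Set.pairwise_insert]
  exact ⟨hI, fun w hw _ => ⟨fun h => hv w h hw, fun h => hv w h.symm hw⟩⟩

variable [Fintype V] {lam : ℝ}

lemma sum_pow_card_pos (hl : 0 < lam) : 0 < ∑ J : IndepSets G, lam ^ J.1.card :=
  Finset.sum_pos (fun _ _ => pow_pos hl _) ⟨⟨∅, by simp⟩, Finset.mem_univ _⟩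

lemma hardCore_nonneg (hl : 0 < lam) (I : IndepSets G) : 0 ≤ hardCore G lam I :=
  div_nonneg (pow_pos hl _).le (sum_pow_card_pos hl).le

lemma sum_hardCore (hl : 0 < lam) : ∑ I, hardCore G lam I = 1 := by
  simp only [hardCore]
  rw [← Finset.sum_div, div_self (sum_pow_card_pos hl).ne']

variable [DecidableEq V]

lemma sum_indepSets_ite_eq {I : Finset V} (hI : G.IsIndepSet (I : Set V)) :
    ∑ J : IndepSets G, (if J.1 = I then (1 : ℝ) else 0) = 1 := by
  set I' : IndepSets G := ⟨I, hI⟩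
  rw [Finset.sum_eq_single I' (fun J _ hJ => if_neg fun h => hJ (Subtype.ext h))
    fun h => absurd (Finset.mem_univ I') h]
  exact if_pos rfl

open Classical in
/-- The probability that the Glauber dynamics moves from `I` to `J` when it updates the vertex
`v`. -/
def glauberAt (G : SimpleGraph V) (lam : ℝ) (v : V) (I J : IndepSets G) : ℝ :=
  if ∀ w, G.Adj v w → w ∉ I.1 then
    lam / (lam + 1) * (if J.1 = insert v I.1 then 1 else 0)
      + (1 - lam / (lam + 1)) * (if J.1 = I.1.erase v then 1 else 0)
  else (if J.1 = I.1.erase v then 1 else 0)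

lemma glauber_apply (I J : IndepSets G) :
    glauber G lam I J = (1 / (Fintype.card V : ℝ)) * ∑ v, glauberAt G lam v I J :=
  rfl

lemma glauberAt_nonneg (hl : 0 < lam) (v : V) (I J : IndepSets G) :
    0 ≤ glauberAt G lam v I J := by
  have hocc : 0 ≤ lam / (lam + 1) := by positivity
  have hunocc : 0 ≤ 1 - lam / (lam + 1) :=
    sub_nonneg.2 (div_le_one_of_le₀ (by linarith) (by linarith))
  unfold glauberAt
  split_ifs <;> simp [hocc, hunocc]

lemma sum_glauberAt (v : V) (I : IndepSets G) : ∑ J, glauberAt G lam v I J = 1 := by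
  have herase := sum_indepSets_ite_eq (I.2.mono (Finset.coe_subset.2 (Finset.erase_subset v I.1)))
  unfold glauberAt
  split_ifs with h
  · rw [Finset.sum_add_distrib, ← Finset.mul_sum, ← Finset.mul_sum,
      sum_indepSets_ite_eq (isIndepSet_insert I.2 h), herase]
    ring
  · exact herase

lemma eq_or_eq_insert_of_glauberAt_ne_zero {v : V} {I J : IndepSets G}
    (h : glauberAt G lam v I J ≠ 0) :
    I = J ∨ (v ∉ I.1 ∧ J.1 = insert v I.1) ∨ (v ∉ J.1 ∧ I.1 = insert v J.1) := by
  have hJ : J.1 = insert v I.1 ∨ J.1 = I.1.erase v := by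
    by_contra! hne
    exact h (by simp [glauberAt, hne.1, hne.2])
  by_cases hv : v ∈ I.1
  · rw [Finset.insert_eq_of_mem hv] at hJ
    rcases hJ with hJ | hJ
    · exact Or.inl (Subtype.ext hJ.symm)
    · exact Or.inr (Or.inr (by simp [hJ, Finset.insert_erase hv]))
  · rw [Finset.erase_eq_of_notMem hv] at hJ
    rcases hJ with hJ | hJ
    · exact Or.inr (Or.inl ⟨hv, hJ⟩)
    · exact Or.inl (Subtype.ext hJ.symm)

lemma glauberAt_balance_insert (hl : 0 < lam) {v : V} {I J : IndepSets G} (hv : v ∉ I.1)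
    (hJ : J.1 = insert v I.1) :
    lam ^ I.1.card * glauberAt G lam v I J = lam ^ J.1.card * glauberAt G lam v J I := by
  have hvJ : v ∈ J.1 := hJ ▸ Finset.mem_insert_self v I.1
  have hne : J.1 ≠ I.1 := fun h => hv (h ▸ hvJ)
  have hfreeJ : ∀ w, G.Adj v w → w ∉ J.1 := fun w hw hwJ => J.2 hvJ hwJ hw.ne hw
  have hfreeI : ∀ w, G.Adj v w → w ∉ I.1 := fun w hw hwI =>
    hfreeJ w hw (hJ ▸ Finset.mem_insert_of_mem hwI)
  have hIJ : glauberAt G lam v I J = lam / (lam + 1) := by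
    rw [glauberAt, if_pos hfreeI, if_pos hJ, Finset.erase_eq_of_notMem hv, if_neg hne]
    ring
  have hJI : glauberAt G lam v J I = 1 - lam / (lam + 1) := by
    rw [glauberAt, if_pos hfreeJ, Finset.insert_eq_of_mem hvJ, if_neg hne.symm, hJ,
      Finset.erase_insert hv, if_pos rfl]
    ring
  rw [hIJ, hJI, hJ, Finset.card_insert_of_notMem hv, pow_succ]
  field_simp
  ring

lemma glauberAt_balance (hl : 0 < lam) (v : V) (I J : IndepSets G) :
    lam ^ I.1.card * glauberAt G lam v I J = lam ^ J.1.card * glauberAt G lam v J I := by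
  have hmove : ∀ {I J : IndepSets G}, glauberAt G lam v I J ≠ 0 →
      lam ^ I.1.card * glauberAt G lam v I J = lam ^ J.1.card * glauberAt G lam v J I := by
    intro I J h
    rcases eq_or_eq_insert_of_glauberAt_ne_zero h with rfl | ⟨hv, hJ⟩ | ⟨hv, hI⟩
    · rfl
    · exact glauberAt_balance_insert hl hv hJ
    · exact (glauberAt_balance_insert hl hv hI).symm
  by_cases hIJ : glauberAt G lam v I J = 0
  · by_cases hJI : glauberAt G lam v J I = 0
    · rw [hIJ, hJI, mul_zero, mul_zero]
    · exact (hmove hJI).symm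
  · exact hmove hIJ

lemma isReversibleChain_glauber [Nonempty V] (hl : 0 < lam) :
    IsReversibleChain (glauber G lam) (hardCore G lam) := by
  refine ⟨Matrix.mem_rowStochastic_iff_sum.2 ⟨fun I J => ?_, fun I => ?_⟩, fun I J => ?_⟩
  · exact mul_nonneg (by positivity) (Finset.sum_nonneg fun v _ => glauberAt_nonneg hl v I J)
  · simp only [glauber_apply]
    rw [← Finset.mul_sum, Finset.sum_comm, Finset.sum_congr rfl fun v _ => sum_glauberAt v I]
    simp
  · have h : lam ^ I.1.card * ∑ v, glauberAt G lam v I J =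
        lam ^ J.1.card * ∑ v, glauberAt G lam v J I := by
      rw [Finset.mul_sum, Finset.mul_sum]
      exact Finset.sum_congr rfl fun v _ => glauberAt_balance hl v I J
    simp only [glauber_apply, hardCore]
    linear_combination (1 / (Fintype.card V : ℝ)) * (1 / ∑ J : IndepSets G, lam ^ J.1.card) * h

lemma updatesAtMost_glauber : UpdatesAtMost 1 (glauber G lam) := by
  intro I J h
  rw [glauber_apply] at h
  obtain ⟨v, -, hv⟩ := Finset.exists_ne_zero_of_sum_ne_zero (right_ne_zero_of_mul h)
  suffices hsub : symmDiff I.1 J.1 ⊆ {v} from Finset.card_le_card hsub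
  intro w hw
  rw [Finset.mem_symmDiff] at hw
  rw [Finset.mem_singleton]
  rcases eq_or_eq_insert_of_glauberAt_ne_zero hv with rfl | ⟨-, hJ⟩ | ⟨-, hI⟩
  · tauto
  · rw [hJ, Finset.mem_insert] at hw
    tauto
  · rw [hI, Finset.mem_insert] at hw
    tauto

end Glauber

section IndepSetsMatchingGraph

variable {n d : ℕ} (σ : Fin d → Equiv.Perm (Fin n))

lemma isIndepSet_matchingGraph_iff (I : Finset (Fin n ⊕ Fin n)) :
    (matchingGraph σ).IsIndepSet (I : Set (Fin n ⊕ Fin n)) ↔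
      (I.toLeft, I.toRight) ∈ indepPairs σ := by
  simp only [mem_indepPairs, Finset.mem_toLeft, Finset.mem_toRight]
  constructor
  · intro h k i hi hk
    refine h hi hk Sum.inl_ne_inr ?_
    exact (SimpleGraph.fromRel_adj _ _ _).2 ⟨Sum.inl_ne_inr, Or.inl ⟨i, k, rfl, rfl⟩⟩
  · intro h u hu v hv _ hadj
    rcases ((SimpleGraph.fromRel_adj _ _ _).1 hadj).2 with ⟨i, k, rfl, rfl⟩ | ⟨i, k, rfl, rfl⟩
    · exact h k i hu hv
    · exact h k i hv hu

lemma sum_indepSets_matchingGraph (f : Finset (Fin n) × Finset (Fin n) → ℝ) :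
    ∑ I : IndepSets (matchingGraph σ), f (I.1.toLeft, I.1.toRight) = ∑ p ∈ indepPairs σ, f p :=
  Finset.sum_bij' (fun I _ => (I.1.toLeft, I.1.toRight))
    (fun p hp => ⟨p.1.disjSum p.2, (isIndepSet_matchingGraph_iff σ _).2 (by simpa using hp)⟩)
    (fun I _ => (isIndepSet_matchingGraph_iff σ _).1 I.2) (fun _ _ => Finset.mem_univ _)
    (fun _ _ => Subtype.ext Finset.toLeft_disjSum_toRight) (fun _ _ => by simp) fun _ _ => rfl

end IndepSetsMatchingGraph

/-! ### Weights of independent sets by imbalance -/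

section Tilting

lemma sum_mul_exp_le {ι : Type*} {s : Finset ι} {w D : ι → ℝ} (hw : ∀ i, 0 ≤ w i) {η M : ℝ}
    (hη : 0 ≤ η) (hD : ∀ i, D i ≤ M) (ℓ : ℝ) :
    ∑ i ∈ s, w i * Real.exp (η * D i) ≤
      (∑ i ∈ s with ℓ < D i, w i) * Real.exp (η * M) + (∑ i ∈ s, w i) * Real.exp (η * ℓ) := by
  rw [← Finset.sum_filter_add_sum_filter_not s (fun i => ℓ < D i), Finset.sum_mul, Finset.sum_mul]
  refine add_le_add (Finset.sum_le_sum fun i _ => ?_) ?_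
  · exact mul_le_mul_of_nonneg_left
      (Real.exp_le_exp.2 (mul_le_mul_of_nonneg_left (hD i) hη)) (hw i)
  · refine (Finset.sum_le_sum fun i hi => ?_).trans
      (Finset.sum_le_sum_of_subset_of_nonneg (Finset.filter_subset _ _)
        fun i _ _ => mul_nonneg (hw i) (Real.exp_nonneg _))
    exact mul_le_mul_of_nonneg_left (Real.exp_le_exp.2
      (mul_le_mul_of_nonneg_left (not_lt.1 (Finset.mem_filter.1 hi).2) hη)) (hw i)

lemma rate_mul_exp (d : ℕ) {lam : ℝ} (hl : 0 < lam) (s α β : ℝ) :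
    rate d (lam * Real.exp s) (lam * Real.exp (-s)) α β = rate d lam lam α β + s * (α - β) := by
  rw [rate, rate, Real.log_mul hl.ne' (Real.exp_ne_zero _),
    Real.log_mul hl.ne' (Real.exp_ne_zero _), Real.log_exp, Real.log_exp]
  ring

end Tilting

section Imbalance

variable {n : ℕ}

/-- How many more vertices a set of vertices, given by its left and its right part, has on the left
than on the right. -/
def imbalance (p : Finset (Fin n) × Finset (Fin n)) : ℝ := p.1.card - p.2.card

lemma abs_imbalance_le (p : Finset (Fin n) × Finset (Fin n)) : |imbalance p| ≤ n :=
  abs_sub_le_of_nonneg_of_le (Nat.cast_nonneg _) (Nat.cast_le.2 (card_finset_fin_le p.1))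
    (Nat.cast_nonneg _) (Nat.cast_le.2 (card_finset_fin_le p.2))

variable {d : ℕ} (σ : Fin d → Equiv.Perm (Fin n)) (lam : ℝ)

open Classical in
/-- The total hard-core weight of the independent sets of the matching graph whose imbalance is in
`T`. -/
def imbalanceWeight (T : Set ℝ) : ℝ :=
  ∑ p ∈ indepPairs σ with imbalance p ∈ T, lam ^ (p.1.card + p.2.card)

open Classical in
lemma imbalanceWeight_eq_sum_numPairs (T : Set ℝ) :
    imbalanceWeight σ lam T =
      ∑ q ∈ Finset.range (n + 1) ×ˢ Finset.range (n + 1) with (q.1 - q.2 : ℝ) ∈ T,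
        numPairs σ q.1 q.2 * lam ^ (q.1 + q.2) := by
  have hmaps : ∀ p ∈ (indepPairs σ).filter fun p => imbalance p ∈ T, (p.1.card, p.2.card) ∈
      (Finset.range (n + 1) ×ˢ Finset.range (n + 1)).filter fun q => (q.1 - q.2 : ℝ) ∈ T := by
    intro p hp
    simp only [Finset.mem_filter, Finset.mem_product, Finset.mem_range, Nat.lt_succ_iff]
    exact ⟨⟨card_finset_fin_le p.1, card_finset_fin_le p.2⟩, (Finset.mem_filter.1 hp).2⟩
  rw [imbalanceWeight, ← Finset.sum_fiberwise_of_maps_to hmaps]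
  refine Finset.sum_congr rfl fun q hq => ?_
  have hfiber : ((indepPairs σ).filter fun p => imbalance p ∈ T).filter
      (fun p => (p.1.card, p.2.card) = q) =
      (indepPairs σ).filter fun p => p.1.card = q.1 ∧ p.2.card = q.2 := by
    rw [Finset.filter_filter]
    refine Finset.filter_congr fun p _ => ?_
    rw [Prod.ext_iff, and_iff_right_iff_imp]
    rintro ⟨hleft : p.1.card = q.1, hright : p.2.card = q.2⟩
    rw [imbalance, hleft, hright]
    exact (Finset.mem_filter.1 hq).2
  rw [hfiber, numPairs, ← nsmul_eq_mul]
  refine Finset.sum_eq_card_nsmul fun p hp => ?_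
  rw [(Finset.mem_filter.1 hp).2.1, (Finset.mem_filter.1 hp).2.2]

lemma pairZ_mul_exp (s : ℝ) :
    pairZ σ (lam * Real.exp s) (lam * Real.exp (-s)) =
      ∑ p ∈ indepPairs σ, lam ^ (p.1.card + p.2.card) * Real.exp (s * imbalance p) := by
  refine Finset.sum_congr rfl fun p _ => ?_
  rw [mul_pow, mul_pow, ← Real.exp_nat_mul, ← Real.exp_nat_mul, pow_add, mul_mul_mul_comm,
    ← Real.exp_add, imbalance]
  ring_nf

lemma pairZ_mul_exp_le {lam : ℝ} (hl : 0 ≤ lam) {η s : ℝ} (hη : 0 ≤ η) (hs : |s| = 1) (ℓ : ℝ) :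
    pairZ σ (lam * Real.exp (η * s)) (lam * Real.exp (-(η * s))) ≤
      imbalanceWeight σ lam {u | ℓ < s * u} * Real.exp (η * n) +
        imbalanceWeight σ lam Set.univ * Real.exp (η * ℓ) := by
  have hD : ∀ p : Finset (Fin n) × Finset (Fin n), s * imbalance p ≤ n := fun p =>
    (le_abs_self _).trans (by simpa only [abs_mul, hs, one_mul] using abs_imbalance_le p)
  simp only [pairZ_mul_exp, mul_assoc, imbalanceWeight, Set.mem_ofPred_eq, Set.mem_univ,
    Finset.filter_true]
  convert sum_mul_exp_le (s := indepPairs σ) (w := fun p => lam ^ (p.1.card + p.2.card))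
    (fun p => by positivity) hη hD ℓ

end Imbalance

section TypicalWeights

/-- The sub-linear error on the logarithmic scale between the weights of the independent sets for
typical matchings and the exponential rate. -/
def logError (d n : ℕ) : ℝ := (9 + 2 * d) * (Real.log (n + 1) + 1)

lemma eventually_logError_add_le (d : ℕ) (C : ℝ) {κ : ℝ} (hκ : 0 < κ) :
    ∀ᶠ n : ℕ in atTop, logError d n + C ≤ κ * n := by
  have hC : Tendsto (fun n : ℕ => C / n) atTop (𝓝 0) :=
    tendsto_const_nhds.div_atTop tendsto_natCast_atTop_atTop
  have hlim := (tendsto_log_add_one_div (9 + 2 * d)).add hC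
  rw [add_zero] at hlim
  filter_upwards [hlim.eventually_le_const hκ, eventually_gt_atTop 0] with n hle hn
  rwa [← add_div, div_le_iff₀ (Nat.cast_pos.2 hn)] at hle

variable {n d : ℕ}

lemma div_mem_densities {a b : ℕ} (h : a + b ≤ n) : ((a / n, b / n) : ℝ × ℝ) ∈ densities := by
  refine ⟨by positivity, by positivity, ?_⟩
  dsimp only
  rw [← add_div]
  exact div_le_one_of_le₀ (by exact_mod_cast h) (Nat.cast_nonneg n)

lemma expectedPairs_eq_zero (hd : d ≠ 0) {a b : ℕ} (hb : b ≤ n) (h : n < a + b) :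
    expectedPairs d n a b = 0 := by
  rw [expectedPairs, avoidProb, Nat.choose_eq_zero_of_lt (by omega : n - b < a)]
  simp [hd]

variable {lam : ℝ}

lemma expectedPairs_mul_pow_le (hn : n ≠ 0) (hl : 0 < lam) {a b : ℕ} (h : a + b ≤ n) :
    expectedPairs d n a b * lam ^ (a + b) ≤
      Real.exp (n * rate d lam lam (a / n) (b / n) + (4 + 2 * d) * (Real.log (n + 1) + 1)) := by
  have hE := expectedPairs_pos d h
  rw [← Real.log_le_iff_le_exp (by positivity), Real.log_mul hE.ne' (by positivity), Real.log_pow]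
  push_cast
  linarith [(abs_le.1 (abs_log_expectedPairs_sub_le d hn h lam lam)).2]

variable {σ : Fin d → Equiv.Perm (Fin n)}

lemma numPairs_mul_pow_le (hσ : σ ∈ typicalMatchings n d) (hd : d ≠ 0) (hn : n ≠ 0) (hl : 0 < lam)
    {r : ℝ} {a b : ℕ} (ha : a ≤ n) (hb : b ≤ n)
    (hr : a + b ≤ n → rate d lam lam (a / n) (b / n) ≤ r) :
    numPairs σ a b * lam ^ (a + b) ≤
      ((n : ℝ) + 1) ^ 3 * Real.exp (n * r + (4 + 2 * d) * (Real.log (n + 1) + 1)) := by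
  refine (mul_le_mul_of_nonneg_right (hσ a ha b hb) (by positivity)).trans ?_
  rw [mul_assoc]
  refine mul_le_mul_of_nonneg_left ?_ (by positivity)
  rcases le_or_gt (a + b) n with h | h
  · refine (expectedPairs_mul_pow_le hn hl h).trans (Real.exp_le_exp.2 ?_)
    gcongr
    exact hr h
  · rw [expectedPairs_eq_zero hd hb h, zero_mul]
    exact Real.exp_nonneg _

theorem imbalanceWeight_le (hσ : σ ∈ typicalMatchings n d) (hd : d ≠ 0) (hn : n ≠ 0)
    (hl : 0 < lam) {T : Set ℝ} {r : ℝ}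
    (hT : ∀ p ∈ densities, n * (p.1 - p.2) ∈ T → rate d lam lam p.1 p.2 ≤ r) :
    imbalanceWeight σ lam T ≤ Real.exp (n * r + logError d n) := by
  classical
  set E : ℝ := Real.exp (n * r + (4 + 2 * d) * (Real.log (n + 1) + 1))
  have hterm : ∀ q ∈ (Finset.range (n + 1) ×ˢ Finset.range (n + 1)).filter
      fun q => (q.1 - q.2 : ℝ) ∈ T,
      (numPairs σ q.1 q.2 * lam ^ (q.1 + q.2) : ℝ) ≤ ((n : ℝ) + 1) ^ 3 * E := by
    rintro ⟨a, b⟩ hq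
    simp only [Finset.mem_filter, Finset.mem_product, Finset.mem_range, Nat.lt_succ_iff] at hq
    refine numPairs_mul_pow_le hσ hd hn hl hq.1.1 hq.1.2 fun h => hT _ (div_mem_densities h) ?_
    dsimp only
    rw [← sub_div, mul_div_cancel₀ _ (Nat.cast_ne_zero.2 hn)]
    exact hq.2
  have hcard : (((Finset.range (n + 1) ×ˢ Finset.range (n + 1)).filter
      fun q => (q.1 - q.2 : ℝ) ∈ T).card : ℝ) ≤ ((n : ℝ) + 1) ^ 2 := by
    have h := Finset.card_filter_le (Finset.range (n + 1) ×ˢ Finset.range (n + 1))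
      fun q => (q.1 - q.2 : ℝ) ∈ T
    rw [Finset.card_product, Finset.card_range, ← sq] at h
    exact_mod_cast h
  calc imbalanceWeight σ lam T
      = _ := imbalanceWeight_eq_sum_numPairs σ lam T
    _ ≤ _ := Finset.sum_le_card_nsmul _ _ _ hterm
    _ ≤ ((n : ℝ) + 1) ^ 2 * (((n : ℝ) + 1) ^ 3 * E) := by
        rw [nsmul_eq_mul]
        exact mul_le_mul_of_nonneg_right hcard (by positivity)
    _ = Real.exp (5 * Real.log (n + 1)) * E := by
        rw [mul_comm 5, Real.exp_mul, Real.exp_log (by positivity)]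
        norm_cast
        push_cast
        ring
    _ ≤ Real.exp (n * r + logError d n) := by
        rw [← Real.exp_add, logError]
        exact Real.exp_le_exp.2 (by linarith)

theorem exp_le_imbalanceWeight (hσ : σ ∈ typicalMatchings n d) (hd : d ≠ 0) (hn : n ≠ 0)
    (hl : 0 < lam) {R δ η s : ℝ} (hη : 0 ≤ η) (hδ : 0 ≤ δ) (hs : |s| = 1)
    (hR : ∀ p ∈ densities, rate d lam lam p.1 p.2 ≤ R) {p : ℝ × ℝ} (hp : p ∈ densities)
    (hpR : R ≤ rate d lam lam p.1 p.2) (hpδ : δ ≤ s * (p.1 - p.2))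
    (hlarge : logError d n + Real.log 2 ≤ η * δ / 2 * n) :
    Real.exp (n * (R - η)) / 2 ≤ imbalanceWeight σ lam {u | δ / 2 * n < s * u} := by
  have hupper : imbalanceWeight σ lam Set.univ ≤ Real.exp (n * R + logError d n) :=
    imbalanceWeight_le hσ hd hn hl fun q hq _ => hR q hq
  have htilt : Real.exp (n * (R + η * δ)) ≤
      imbalanceWeight σ lam {u | δ / 2 * n < s * u} * Real.exp (η * n) +
        Real.exp (n * R + logError d n) * Real.exp (η * (δ / 2 * n)) :=
    calc Real.exp (n * (R + η * δ))
        ≤ Real.exp (n * rate d (lam * Real.exp (η * s)) (lam * Real.exp (-(η * s))) p.1 p.2) := by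
          rw [rate_mul_exp d hl, mul_assoc]
          gcongr
      _ ≤ pairZ σ (lam * Real.exp (η * s)) (lam * Real.exp (-(η * s))) :=
          exp_rate_le_pairZ σ (Nat.pos_of_ne_zero hd) (by positivity) (by positivity) hp
      _ ≤ _ := (pairZ_mul_exp_le σ hl.le hη hs (δ / 2 * n)).trans (by gcongr)
  have hhalf : Real.exp (n * R + logError d n) * Real.exp (η * (δ / 2 * n)) ≤
      Real.exp (n * (R + η * δ)) / 2 := by
    rw [le_div_iff₀ two_pos, ← Real.exp_add]
    nth_rewrite 2 [← Real.exp_log (two_pos (α := ℝ))]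
    rw [← Real.exp_add]
    exact Real.exp_le_exp.2 (by linarith)
  refine le_of_mul_le_mul_right ?_ (Real.exp_pos (η * n))
  calc Real.exp (n * (R - η)) / 2 * Real.exp (η * n) = Real.exp (n * R) / 2 := by
        rw [div_mul_eq_mul_div, ← Real.exp_add]
        ring_nf
    _ ≤ Real.exp (n * (R + η * δ)) / 2 := by
        gcongr
        exact le_add_of_nonneg_right (mul_nonneg hη hδ)
    _ ≤ _ := by linarith

end TypicalWeights

/-! ### Slow mixing for typical matchings -/

section MixingTime

variable {n d : ℕ}

lemma imbalance_sub_le_card_symmDiff (I J : Finset (Fin n ⊕ Fin n)) :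
    imbalance (I.toLeft, I.toRight) - imbalance (J.toLeft, J.toRight) ≤ (symmDiff I J).card := by
  have hleft : (I.toLeft \ J.toLeft).card ≤ (symmDiff I J).toLeft.card := by
    rw [← Finset.toLeft_sdiff]
    exact Finset.card_le_card (Finset.toLeft_monotone le_sup_left)
  have hright : (J.toRight \ I.toRight).card ≤ (symmDiff I J).toRight.card := by
    rw [← Finset.toRight_sdiff]
    exact Finset.card_le_card (Finset.toRight_monotone le_sup_right)
  have hI := Finset.card_le_card_sdiff_add_card (s := I.toLeft) (t := J.toLeft)
  have hJ := Finset.card_le_card_sdiff_add_card (s := J.toRight) (t := I.toRight)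
  have hsum := Finset.card_toLeft_add_card_toRight (u := symmDiff I J)
  have h : (I.toLeft.card + J.toRight.card : ℝ) ≤
      J.toLeft.card + I.toRight.card + (symmDiff I J).card := by
    exact_mod_cast (by omega)
  rw [imbalance, imbalance]
  linarith

lemma abs_imbalance_sub_le_card_symmDiff (I J : Finset (Fin n ⊕ Fin n)) :
    |imbalance (I.toLeft, I.toRight) - imbalance (J.toLeft, J.toRight)| ≤
      (symmDiff I J).card :=
  abs_sub_le_iff.2 ⟨imbalance_sub_le_card_symmDiff I J,
    symmDiff_comm J I ▸ imbalance_sub_le_card_symmDiff J I⟩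

variable {σ : Fin d → Equiv.Perm (Fin n)} {lam : ℝ}

lemma sum_hardCore_imbalance (T : Set ℝ)
    [DecidablePred fun I : IndepSets (matchingGraph σ) =>
      imbalance (I.1.toLeft, I.1.toRight) ∈ T] :
    ∑ I : IndepSets (matchingGraph σ) with imbalance (I.1.toLeft, I.1.toRight) ∈ T,
      hardCore (matchingGraph σ) lam I =
    imbalanceWeight σ lam T / ∑ J : IndepSets (matchingGraph σ), lam ^ J.1.card := by
  classical
  simp only [hardCore, imbalanceWeight]
  rw [← Finset.sum_div, Finset.sum_filter, Finset.sum_filter, ← sum_indepSets_matchingGraph]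
  simp only [Finset.card_toLeft_add_card_toRight]

theorem ofReal_div_four_le_mixingTime_of_imbalanceWeight (hl : 0 < lam) {ℓ w b : ℝ} {k : ℕ}
    (hk : k ≤ ℓ) (hw : 0 < w) (hb : 0 ≤ b)
    (hside : ∀ s : ℝ, |s| = 1 → w ≤ imbalanceWeight σ lam {u | ℓ < s * u})
    (hmiddle : b * imbalanceWeight σ lam {u | |u| ≤ ℓ} ≤ w)
    {P : Matrix (IndepSets (matchingGraph σ)) (IndepSets (matchingGraph σ)) ℝ}
    (hP : IsReversibleChain P (hardCore (matchingGraph σ) lam)) (hPk : UpdatesAtMost k P) :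
    ENNReal.ofReal (b / 4) ≤ (mixingTime P (hardCore (matchingGraph σ) lam) : ENNReal) := by
  have hZ := sum_pow_card_pos (G := matchingGraph σ) hl
  refine hP.ofReal_div_four_le_mixingTime (hardCore_nonneg hl) (sum_hardCore hl)
    (D := fun I => imbalance (I.1.toLeft, I.1.toRight)) ((Nat.cast_nonneg k).trans hk)
    (div_pos hw hZ) hb (fun I J hIJ => ?_) (fun s hs => ?_) ?_
  · exact (abs_imbalance_sub_le_card_symmDiff I.1 J.1).trans
      ((Nat.cast_le.2 (hPk I J hIJ)).trans hk)
  · exact (div_le_div_of_nonneg_right (hside s hs) hZ.le).trans_eq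
      (sum_hardCore_imbalance {u | ℓ < s * u}).symm
  · refine (congrArg (b * ·) (sum_hardCore_imbalance {u | |u| ≤ ℓ})).trans_le ?_
    rw [← mul_div_assoc]
    exact div_le_div_of_nonneg_right hmiddle hZ.le

theorem exists_forall_typicalMatchings_le_mixingTime (hd : 3 ≤ d) (hl : lamCrit d < lam) :
    ∃ a : ℝ, 1 < a ∧ ∃ ρ : ℝ, 0 < ρ ∧ ∀ᶠ n : ℕ in atTop, ∀ σ ∈ typicalMatchings n d,
      ∀ k : ℕ, (k : ℝ) ≤ ρ * n →
      ∀ P : Matrix (IndepSets (matchingGraph σ)) (IndepSets (matchingGraph σ)) ℝ,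
        IsReversibleChain P (hardCore (matchingGraph σ) lam) → UpdatesAtMost k P →
        ENNReal.ofReal (1 / 4 * a ^ n) ≤
          (mixingTime P (hardCore (matchingGraph σ) lam) : ENNReal) := by
  have hlam : 0 < lam := (lamCrit_pos hd).trans hl
  have hd0 : d ≠ 0 := by omega
  obtain ⟨R, ε, hε, hR, hgap, hmax⟩ := exists_rate_gap hd hl
  refine ⟨Real.exp (ε / 4), Real.one_lt_exp_iff.2 (by positivity), ε / 2, by positivity, ?_⟩
  filter_upwards [eventually_logError_add_le d (Real.log 2) (by positivity : 0 < ε / 4 * ε / 2),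
    eventually_logError_add_le d (Real.log 2) (half_pos hε), eventually_ne_atTop 0]
    with n hside hmiddle hn σ hσ k hk P hP hPk
  have hlight : imbalanceWeight σ lam {u | |u| ≤ ε / 2 * n} ≤
      Real.exp (n * (R - ε) + logError d n) := by
    refine imbalanceWeight_le hσ hd0 hn hlam fun p hp hpn => hgap p hp ?_
    have hn0 : (0 : ℝ) < n := by positivity
    rw [Set.mem_ofPred_eq, abs_mul, abs_of_pos hn0, mul_comm, mul_le_mul_iff_left₀ hn0] at hpn
    linarith
  rw [one_div_mul_eq_div]
  refine ofReal_div_four_le_mixingTime_of_imbalanceWeight hlam hk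
    (w := Real.exp (n * (R - ε / 4)) / 2) (by positivity) (by positivity) (fun s hs => ?_) ?_ hP hPk
  · obtain ⟨p, hp, hpR, hpε⟩ := hmax s hs
    exact exp_le_imbalanceWeight hσ hd0 hn hlam (by positivity) hε.le hs hR hp hpR hpε hside
  · calc Real.exp (ε / 4) ^ n * imbalanceWeight σ lam {u | |u| ≤ ε / 2 * n}
        ≤ Real.exp (n * (ε / 4)) * Real.exp (n * (R - ε) + logError d n) := by
          rw [← Real.exp_nat_mul]
          gcongr
      _ = Real.exp (n * (ε / 4) + (n * (R - ε) + logError d n) + Real.log 2) / 2 := by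
          rw [← Real.exp_add, Real.exp_add _ (Real.log 2), Real.exp_log two_pos,
            mul_div_cancel_right₀ _ two_ne_zero]
      _ ≤ Real.exp (n * (R - ε / 4)) / 2 := by
          gcongr
          linarith

end MixingTime

lemma tendsto_matchingProb_one {d : ℕ} {E : ∀ n : ℕ, Set (Fin d → Equiv.Perm (Fin n))}
    (h : ∀ᶠ n in atTop, typicalMatchings n d ⊆ E n) :
    Tendsto (fun n => matchingProb n d (E n)) atTop (𝓝 1) := by
  have hlower : Tendsto (fun n : ℕ => 1 - 1 / ((n : ℝ) + 1)) atTop (𝓝 1) := by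
    simpa only [sub_zero] using tendsto_one_div_add_atTop_nhds_zero_nat.const_sub (1 : ℝ)
  refine tendsto_of_tendsto_of_tendsto_of_le_of_le' hlower tendsto_const_nhds ?_
    (Eventually.of_forall fun n => matchingProb_le_one (E n))
  filter_upwards [h] with n hn
  exact (one_sub_le_matchingProb_typicalMatchings n d).trans (matchingProb_mono hn)

end HardCore

end

theorem theorem1_general (d : ℕ) (hd : 3 ≤ d) (lam : ℝ) (hl : HardCore.lamCrit d < lam) :
    ∃ a : ℝ, 1 < a ∧ ∃ c : ℝ, 0 < c ∧ ∃ ρ : ℝ, 0 < ρ ∧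
      Tendsto (fun n : ℕ => HardCore.matchingProb n d
        {σ | ENNReal.ofReal (c * a ^ n) ≤
          (HardCore.mixingTime (HardCore.glauber (HardCore.matchingGraph σ) lam)
            (HardCore.hardCore (HardCore.matchingGraph σ) lam) : ENNReal)})
        atTop (𝓝 1) ∧
      ∀ k : ℕ → ℕ, (∀ᶠ n in atTop, (k n : ℝ) ≤ ρ * n) →
        Tendsto (fun n : ℕ => HardCore.matchingProb n d
          {σ | ∀ P : Matrix (HardCore.IndepSets (HardCore.matchingGraph σ))
                (HardCore.IndepSets (HardCore.matchingGraph σ)) ℝ,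
            HardCore.IsReversibleChain P
              (HardCore.hardCore (HardCore.matchingGraph σ) lam) →
            HardCore.UpdatesAtMost (k n) P →
            ENNReal.ofReal (c * a ^ n) ≤
              (HardCore.mixingTime P
                (HardCore.hardCore (HardCore.matchingGraph σ) lam) : ENNReal)})
          atTop (𝓝 1) := by
  obtain ⟨a, ha, ρ, hρ, hmix⟩ := HardCore.exists_forall_typicalMatchings_le_mixingTime hd hl
  refine ⟨a, ha, 1 / 4, by norm_num, ρ, hρ, HardCore.tendsto_matchingProb_one ?_,
    fun k hk => HardCore.tendsto_matchingProb_one ?_⟩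
  · have hone : ∀ᶠ n : ℕ in atTop, 1 ≤ ρ * n :=
      (tendsto_natCast_atTop_atTop.const_mul_atTop hρ).eventually_ge_atTop 1
    filter_upwards [hmix, hone, eventually_ne_atTop 0] with n hn hρn hn0 σ hσ
    have : NeZero n := ⟨hn0⟩
    exact hn σ hσ 1 (by exact_mod_cast hρn) _
      (HardCore.isReversibleChain_glauber ((HardCore.lamCrit_pos hd).trans hl))
      HardCore.updatesAtMost_glauber
  · filter_upwards [hmix, hk] with n hn hkn σ hσ using hn σ hσ (k n) hkn

theorem theorem1 (d : ℕ) (hd : 3 ≤ d) :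
    ∃ ε : ℝ, 0 < ε ∧ ∀ lam : ℝ,
      HardCore.lamCrit d < lam → lam < HardCore.lamCrit d + ε →
      ∃ a : ℝ, 1 < a ∧ ∃ c : ℝ, 0 < c ∧
        Tendsto (fun n : ℕ => HardCore.matchingProb n d
          {σ | ENNReal.ofReal (c * a ^ n) ≤
            (HardCore.mixingTime (HardCore.glauber (HardCore.matchingGraph σ) lam)
              (HardCore.hardCore (HardCore.matchingGraph σ) lam) : ENNReal)})
          atTop (𝓝 1) ∧
        ∀ k : ℕ → ℕ, (fun n => (k n : ℝ)) =o[atTop] (fun n => (n : ℝ)) →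
          Tendsto (fun n : ℕ => HardCore.matchingProb n d
            {σ | ∀ P : Matrix (HardCore.IndepSets (HardCore.matchingGraph σ))
                  (HardCore.IndepSets (HardCore.matchingGraph σ)) ℝ,
              HardCore.IsReversibleChain P
                (HardCore.hardCore (HardCore.matchingGraph σ) lam) →
              HardCore.UpdatesAtMost (k n) P →
              ENNReal.ofReal (c * a ^ n) ≤
                (HardCore.mixingTime P
                  (HardCore.hardCore (HardCore.matchingGraph σ) lam) : ENNReal)})
            atTop (𝓝 1) := by
  refine ⟨1, one_pos, fun lam hl _ => ?_⟩
  obtain ⟨a, ha, c, hc, ρ, hρ, hglauber, hlocal⟩ := theorem1_general d hd lam hl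
  exact ⟨a, ha, c, hc, hglauber, fun k hk => hlocal k (by simpa using hk.def hρ)⟩
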